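/- Let $n,k\in\mathbb N$, $1<p<2$ and $\Lambda\in\mathbb R$. There is a constant $C>0$ depending only on $n,k,p,\Lambda$ such that the following holds. Let $N\subset\mathbb R^k$ be an embedded $C^2$ submanifold (with the induced metric) whose second fundamental form $A(q)(X,Y)=(D_XY)^{\perp}$ satisfies $|A(q)(X,Y)|\le\Lambda|X||Y|$ for all $q\in N$ and $X,Y\in T_qN$, let $\Omega\subset\mathbb R^n$ be open, and let $u\in W^{1,p}(\Omega,N)\cap C^1(\Omega,N)$ be weakly $p$-harmonic, that is, $$\int_\Omega|\nabla u|^{p-2}\sum_{\alpha=1}^n\nabla_\alpha u\cdot\nabla_\alpha\varphi\,dx+\int_\Omega|\nabla u|^{p-2}\sum_{\alpha=1}^nA(u)(\nabla_\alpha u,\nabla_\alpha u)\cdot\varphi\,dx=0\qquad\text{for all }\varphi\in C^1_0(\Omega,\mathbb R^k),$$ where $|\nabla u|^2=\sum_\alpha|\nabla_\alpha u|^2$ and the integrands are read as $0$ where $\nabla u=0$. Then $u\in W^{2,2}_{\mathrm{loc}}(\Omega_+,N)$, where $\Omega_+=\{x\in\Omega:|\nabla u(x)|>0\}$. Moreover,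 for every ball $B_r=B_r(x_0)$ with $r>0$ and $\overline{B_r}\subset\Omega$, the map $u$ has a weak Hessian $\nabla^2u\in L^2$ on the concentric ball $B_{r/2}$, and $$\int_{B_{r/2}}|\nabla^2u|^2\,dx\le C\left(r^{-2}+M_r^2\right)M_r^{2-p}\int_{B_r}|\nabla u|^p\,dx,\qquad M_r=\sup_{B_r}|\nabla u|.$$ -/

import Mathlib

open MeasureTheory Set Topology
open scoped ContDiff ENNReal

noncomputable section

namespace PHarmonic

/-- The Euclidean space `ℝⁿ`. -/
abbrev Euc (n : ℕ) : Type := EuclideanSpace ℝ (Fin n)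

/-! ### Derivatives and Sobolev spaces on open subsets of `ℝⁿ` -/

/-- The classical partial derivative `∇_α f (x)`. -/
def partialDeriv {n : ℕ} {F : Type*} [NormedAddCommGroup F] [NormedSpace ℝ F]
    (α : Fin n) (f : Euc n → F) (x : Euc n) : F :=
  fderiv ℝ f x (EuclideanSpace.single α 1)

/-- `|∇u(x)| = (∑_α |∇_α u(x)|²)^{1/2}`. -/
def gradNorm {n k : ℕ} (u : Euc n → Euc k) (x : Euc n) : ℝ :=
  √(∑ α, ‖partialDeriv α u x‖ ^ 2)

/-- `φ` is of class `C^j` with compact support contained in `U`. -/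
def IsTestFunction {n : ℕ} {F : Type*} [NormedAddCommGroup F] [NormedSpace ℝ F]
    (j : WithTop ℕ∞) (U : Set (Euc n)) (φ : Euc n → F) : Prop :=
  ContDiff ℝ j φ ∧ HasCompactSupport φ ∧ tsupport φ ⊆ U

/-- `w` is the weak (distributional) partial derivative `∇_α v` on the open set `U`. -/
def HasWeakPartialDeriv {n k : ℕ} (U : Set (Euc n)) (α : Fin n) (v w : Euc n → Euc k) : Prop :=
  LocallyIntegrableOn v U ∧ LocallyIntegrableOn w U ∧
    ∀ φ : Euc n → ℝ, IsTestFunction ∞ U φ →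
      ∫ x in U, partialDeriv α φ x • v x = -∫ x in U, φ x • w x

/-- `H` is the weak Hessian of `v` on the open set `U`: `H α β = ∇_β ∇_α v`. -/
def HasWeakHessian {n k : ℕ} (U : Set (Euc n)) (v : Euc n → Euc k)
    (H : Fin n → Fin n → Euc n → Euc k) : Prop :=
  ∃ G : Fin n → Euc n → Euc k, (∀ α, HasWeakPartialDeriv U α v (G α)) ∧
    ∀ α β, HasWeakPartialDeriv U β (G α) (H α β)

/-- `v ∈ W^{1,p}(U, ℝᵏ)`. -/
def MemW1p {n k : ℕ} (p : ℝ≥0∞) (U : Set (Euc n)) (v : Euc n → Euc k) : Prop :=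
  MemLp v p (volume.restrict U) ∧
    ∀ α, ∃ w, HasWeakPartialDeriv U α v w ∧ MemLp w p (volume.restrict U)

/-- `v ∈ W^{2,p}(U, ℝᵏ)`. -/
def MemW2p {n k : ℕ} (p : ℝ≥0∞) (U : Set (Euc n)) (v : Euc n → Euc k) : Prop :=
  MemW1p p U v ∧
    ∃ H, HasWeakHessian U v H ∧ ∀ α β, MemLp (H α β) p (volume.restrict U)

/-- `v ∈ W^{2,p}_loc(U, ℝᵏ)`: `v ∈ W^{2,p}(V, ℝᵏ)` for all open `V ⊂⊂ U`. -/
def MemW2pLoc {n k : ℕ} (p : ℝ≥0∞) (U : Set (Euc n)) (v : Euc n → Euc k) : Prop :=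
  ∀ V : Set (Euc n), IsOpen V → IsCompact (closure V) → closure V ⊆ U → MemW2p p V v

/-! ### Submanifolds of `ℝᵏ` and their second fundamental form -/

/-- `N` is an embedded `m`-dimensional submanifold of `ℝᵏ` of class `C²` (without boundary):
around each of its points, a `C²` diffeomorphism between open subsets of `ℝᵏ` straightens it to
an `m`-dimensional linear subspace. It carries the metric induced from `ℝᵏ`. -/
def IsC2Submanifold {k : ℕ} (m : ℕ) (N : Set (Euc k)) : Prop :=
  ∀ q ∈ N, ∃ (e : OpenPartialHomeomorph (Euc k) (Euc k)) (W : Submodule ℝ (Euc k)),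
    q ∈ e.source ∧ ContDiffOn ℝ 2 e e.source ∧ ContDiffOn ℝ 2 e.symm e.target ∧
    Module.finrank ℝ W = m ∧ ∀ y ∈ e.source, y ∈ N ↔ e y ∈ W

/-- The tangent space `T_q N`, spanned by the velocities at `q` of curves in `N` through `q`. -/
def tangentSpaceAt {k : ℕ} (N : Set (Euc k)) (q : Euc k) : Submodule ℝ (Euc k) :=
  Submodule.span ℝ {X | ∃ γ : ℝ → Euc k, γ 0 = q ∧ (∀ᶠ t in 𝓝 0, γ t ∈ N) ∧ HasDerivAt γ X 0}

/-- The orthogonal projection of `ℝᵏ` onto `T_q N`. -/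
def tangentProj {k : ℕ} (N : Set (Euc k)) (q : Euc k) : Euc k →L[ℝ] Euc k :=
  (tangentSpaceAt N q).starProjection

/-- The second fundamental form `A(q)(X, Y) = (D_X Y)^⊥` for `q ∈ N` and `X, Y ∈ T_q N`, where the
vector `Y` is extended to the tangential vector field `q' ↦ tangentProj N q' Y` along `N`.
The derivative is taken along `N`; in tangential directions `X` it does not depend on the
choice implicit in `fderivWithin`. -/
def secondFundamentalForm {k : ℕ} (N : Set (Euc k)) (q X Y : Euc k) : Euc k :=
  (tangentSpaceAt N q)ᗮ.starProjection (fderivWithin ℝ (tangentProj N) N q X Y)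

/-- The curvature assumption `|A| ≤ Λ` on `N`. -/
def SecondFundamentalFormBound {k : ℕ} (N : Set (Euc k)) (Λ : ℝ) : Prop :=
  ∀ q ∈ N, ∀ X ∈ tangentSpaceAt N q, ∀ Y ∈ tangentSpaceAt N q,
    ‖secondFundamentalForm N q X Y‖ ≤ Λ * ‖X‖ * ‖Y‖

/-- The weak `p`-harmonic map equation for a `C¹` map `u : Ω → N`. -/
def IsWeaklyPHarmonic {n k : ℕ} (p : ℝ) (Ω : Set (Euc n)) (N : Set (Euc k))
    (u : Euc n → Euc k) : Prop :=
  ∀ φ : Euc n → Euc k, IsTestFunction 1 Ω φ →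
    (∫ x in Ω, gradNorm u x ^ (p - 2) *
        ∑ α, inner ℝ (partialDeriv α u x) (partialDeriv α φ x)) +
      (∫ x in Ω, gradNorm u x ^ (p - 2) *
        ∑ α, inner ℝ
          (secondFundamentalForm N (u x) (partialDeriv α u x) (partialDeriv α u x)) (φ x)) = 0

end PHarmonic

end

/-! Write V(a) = |a|^(p-2) a and let D_h be the difference quotient in a coordinate direction e.
Since ∇u is tangent to N, the curvature bound turns the equation into |∫ V(∇u)·∇φ| ≤ |Λ| ∫ |∇u|^p
|φ| (`IsWeaklyPHarmonic.abs_integral_le`), and N plays no further part. Take φ = D_{-h}(η² D_h u)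
with a cutoff η. Discrete integration by parts produces ∫ η² D_h V(∇u)·D_h ∇u, which strong
monotonicity (`pField_monotone`) bounds below by (p-1) ∫ w |η D_h ∇u|², where w = (|∇u(x)| +
|∇u(x+he)| + h)^(p-2).

For p < 2 the field V is not Lipschitz at 0, so the cutoff term must not contain D_h V. Its quotient
is left on ∇η ⊗ η D_h u (`integral_inner_diffQuot_pField`), and only |V(∇u)| = |∇u|^(p-1) enters.
The remaining second differences occur in segment averages of |η D_h ∇u|. Adjointness
(`integral_mul_segAvg_neg`) moves these averages onto the known factor, and Young's inequality with
weight w absorbs the second differences. As p < 2, 1/w is at most (2M+h)^(2-p) wherever |∇u| ≤ M at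
both points: zeros of ∇u do no harm, and the estimate holds on all of Ω, not only on Ω₊.

As h → 0 the Young remainder carries the power (2-p) + 2(p-1) = p of |∇u|, which is why ∫ |∇u|^p
stands on the right. A weak limit point in L² supplies the second derivatives with the limiting
bound (`exists_weak_second_deriv`), and a rescaled bump function on balls gives the factor r^(-2).
-/

open MeasureTheory Set Topology
open scoped ContDiff ENNReal

noncomputable section

namespace PHarmonic

/-! ### The vector field `a ↦ ‖a‖ ^ (p - 2) • a` -/

section PField

variable {E : Type*} [NormedAddCommGroup E] [InnerProductSpace ℝ E] {p : ℝ}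

/-- The vector field `a ↦ ‖a‖ ^ (p - 2) • a`. -/
def pField (p : ℝ) (a : E) : E := ‖a‖ ^ (p - 2) • a

theorem norm_pField (hp : 1 < p) (a : E) : ‖pField p a‖ = ‖a‖ ^ (p - 1) := by
  rcases eq_or_ne a 0 with rfl | ha
  · simp [pField, Real.zero_rpow (by linarith : p - 1 ≠ 0)]
  · have : 0 < ‖a‖ := norm_pos_iff.2 ha
    rw [pField, norm_smul, Real.norm_of_nonneg (by positivity), ← Real.rpow_add_one this.ne']
    ring_nf

theorem continuous_pField (hp : 1 < p) : Continuous (pField p : E → E) := by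
  rw [continuous_iff_continuousAt]
  intro a
  rcases eq_or_ne a 0 with rfl | ha
  · rw [ContinuousAt, tendsto_iff_norm_sub_tendsto_zero]
    have h0 : pField p (0 : E) = 0 := by simp [pField]
    simp only [h0, sub_zero, norm_pField hp]
    have h : Continuous fun a : E => ‖a‖ ^ (p - 1) :=
      continuous_norm.rpow_const fun _ => Or.inr (by linarith)
    simpa [Real.zero_rpow (by linarith : p - 1 ≠ 0)] using h.tendsto 0
  · exact (continuous_norm.continuousAt.rpow_const (Or.inl (norm_ne_zero_iff.2 ha))).smul
      continuousAt_id

/-- Concavity of t ↦ t^(p-1): its graph lies below the tangent at s. This is Bernoulli's inequality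
at t/s - 1 with exponent p-1 in (0,1), rescaled by s. -/
theorem rpow_tangent_bound (hp₁ : 1 < p) (hp₂ : p < 2) {s t : ℝ} (hs : 0 < s) (ht : 0 ≤ t) :
    (p - 1) * s ^ (p - 2) * (s - t) ≤ s ^ (p - 1) - t ^ (p - 1) := by
  have h := rpow_one_add_le_one_add_mul_self (s := t / s - 1)
    (by linarith [div_nonneg ht hs.le]) (p := p - 1) (by linarith) (by linarith)
  rw [add_sub_cancel, Real.div_rpow ht hs.le, div_le_iff₀ (by positivity)] at h
  have e : s ^ (p - 1) = s ^ (p - 2) * s := by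
    rw [← Real.rpow_add_one hs.ne']; ring_nf
  rw [e] at h ⊢
  have : (1 + (p - 1) * (t / s - 1)) * (s ^ (p - 2) * s)
      = s ^ (p - 2) * s + (p - 1) * s ^ (p - 2) * (t - s) := by
    field_simp
  nlinarith

/-- Strong monotonicity of `a ↦ ‖a‖ ^ (p - 2) • a` for `1 < p < 2`. -/
theorem pField_monotone (hp₁ : 1 < p) (hp₂ : p < 2) {δ : ℝ} (hδ : 0 < δ) (a b : E) :
    (p - 1) * (‖a‖ + ‖b‖ + δ) ^ (p - 2) * ‖a - b‖ ^ 2 ≤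
      inner ℝ (pField p a - pField p b) (a - b) := by
  wlog hab : ‖b‖ ≤ ‖a‖ generalizing a b
  · have := this b a (le_of_not_ge hab)
    rwa [add_comm ‖b‖, ← neg_sub a b, norm_neg, ← neg_sub (pField p a), inner_neg_neg] at this
  have hexp : inner ℝ (pField p a - pField p b) (a - b) = ‖a‖ ^ 2 * ‖a‖ ^ (p - 2)
      + ‖b‖ ^ 2 * ‖b‖ ^ (p - 2) - (‖a‖ ^ (p - 2) + ‖b‖ ^ (p - 2)) * inner ℝ a b := by
    simp only [pField, inner_sub_left, inner_sub_right, real_inner_smul_left,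
      real_inner_self_eq_norm_sq, real_inner_comm b a]
    ring
  have hc : inner ℝ a b ≤ ‖a‖ * ‖b‖ := real_inner_le_norm a b
  have hD : 0 < (‖a‖ + ‖b‖ + δ) ^ (p - 2) := by positivity
  rw [hexp, norm_sub_sq_real]
  rcases eq_or_ne a 0 with rfl | ha
  · have : b = 0 := by simpa using hab
    simp [this]
  have has : 0 < ‖a‖ := norm_pos_iff.2 ha
  have hSD : (‖a‖ + ‖b‖ + δ) ^ (p - 2) ≤ ‖a‖ ^ (p - 2) :=
    Real.rpow_le_rpow_of_nonpos has (by linarith [norm_nonneg b]) (by linarith)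
  -- The comparison `hTD` below is false at b = 0, because `Real.rpow` gives 0 ^ (p - 2) = 0.
  rcases eq_or_ne b 0 with rfl | hb
  · simp only [norm_zero, inner_zero_right] at *
    have : 0 ≤ ‖a‖ ^ 2 := by positivity
    nlinarith [mul_nonneg this (sub_nonneg.2 hSD),
      mul_nonneg (mul_nonneg this hD.le) (by linarith : 0 ≤ 2 - p)]
  have hbs : 0 < ‖b‖ := norm_pos_iff.2 hb
  have hTD : (‖a‖ + ‖b‖ + δ) ^ (p - 2) ≤ ‖b‖ ^ (p - 2) :=
    Real.rpow_le_rpow_of_nonpos hbs (by linarith [norm_nonneg a]) (by linarith)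
  have key := rpow_tangent_bound hp₁ hp₂ has hbs.le
  have ea : ‖a‖ ^ (p - 1) = ‖a‖ ^ (p - 2) * ‖a‖ := by
    rw [← Real.rpow_add_one has.ne']; ring_nf
  have eb : ‖b‖ ^ (p - 1) = ‖b‖ ^ (p - 2) * ‖b‖ := by
    rw [← Real.rpow_add_one hbs.ne']; ring_nf
  rw [ea, eb] at key
  generalize ‖a‖ ^ (p - 2) = S at *
  generalize ‖b‖ ^ (p - 2) = T at *
  generalize (‖a‖ + ‖b‖ + δ) ^ (p - 2) = D at *
  generalize inner ℝ a b = c at *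
  generalize ‖a‖ = s at *
  generalize ‖b‖ = t at *
  -- The difference of the two sides is affine and nonincreasing in c = ⟨a, b⟩, since S, T ≥ D and
  -- p-1 < 1. The worst case is therefore c = s t, where a and b are parallel; there `h2`
  -- (concavity) and `h3` (S ≥ D) suffice.
  have h1 : 0 ≤ (S + T - 2 * ((p - 1) * D)) * (s * t - c) := by
    apply mul_nonneg _ (by linarith)
    nlinarith
  have h2 := mul_le_mul_of_nonneg_right key (sub_nonneg.2 hab)
  have h3 : 0 ≤ (p - 1) * (S - D) * (s - t) ^ 2 :=
    mul_nonneg (mul_nonneg (by linarith) (by linarith)) (sq_nonneg _)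
  linear_combination h1 + h2 + h3

end PField

/-! ### Averages over segments -/

section SegAvg

set_option linter.unusedSectionVars false

variable {X F : Type*} [NormedAddCommGroup X] [NormedSpace ℝ X]
  [NormedAddCommGroup F] [NormedSpace ℝ F]

/-- The average of `f` over the segment from `x` to `x + h • e`. -/
def segAvg (e : X) (f : X → F) (h : ℝ) (x : X) : F :=
  ∫ s in (0 : ℝ)..1, f (x + (s * h) • e)

theorem continuous_segAvg {Z : Type*} [TopologicalSpace Z] {e : X} {f : X → F}
    (hf : Continuous f) {a : Z → ℝ} {b : Z → X} (ha : Continuous a) (hb : Continuous b) :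
    Continuous fun z => segAvg e f (a z) (b z) := by
  have h : Continuous fun q : ℝ × X => segAvg e f q.1 q.2 := by
    unfold segAvg
    exact intervalIntegral.continuous_parametric_intervalIntegral_of_continuous'
      (f := fun (q : ℝ × X) s => f (q.2 + (s * q.1) • e)) (by fun_prop) 0 1
  exact h.comp (ha.prodMk hb)

theorem segAvg_zero [CompleteSpace F] (e : X) (f : X → F) (x : X) : segAvg e f 0 x = f x := by
  simp [segAvg]

theorem intervalIntegrable_segment {e : X} {f : X → F} (hf : Continuous f) (h : ℝ) (x : X) :
    IntervalIntegrable (fun s : ℝ => f (x + (s * h) • e)) volume 0 1 :=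
  Continuous.intervalIntegrable (by fun_prop) _ _

theorem segAvg_mono {e : X} {f g : X → ℝ} (hf : Continuous f) (hg : Continuous g)
    (hfg : ∀ x, f x ≤ g x) (h : ℝ) (x : X) : segAvg e f h x ≤ segAvg e g h x :=
  intervalIntegral.integral_mono_on zero_le_one (intervalIntegrable_segment hf h x)
    (intervalIntegrable_segment hg h x) fun _ _ => hfg _

theorem segAvg_const (e : X) (c h : ℝ) (x : X) : segAvg e (fun _ => c) h x = c := by
  simp [segAvg]

theorem segAvg_add {e : X} {f g : X → F} (hf : Continuous f) (hg : Continuous g)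
    (h : ℝ) (x : X) : segAvg e (fun z => f z + g z) h x = segAvg e f h x + segAvg e g h x :=
  intervalIntegral.integral_add (intervalIntegrable_segment hf h x)
    (intervalIntegrable_segment hg h x)

theorem segAvg_const_mul (e : X) (c : ℝ) (f : X → ℝ) (h : ℝ) (x : X) :
    segAvg e (fun z => c * f z) h x = c * segAvg e f h x :=
  intervalIntegral.integral_const_mul _ _

theorem norm_segAvg_le (e : X) (f : X → F) (h : ℝ) (x : X) :
    ‖segAvg e f h x‖ ≤ segAvg e (fun z => ‖f z‖) h x :=
  intervalIntegral.norm_integral_le_integral_norm zero_le_one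

theorem sub_eq_smul_segAvg [CompleteSpace F] {e : X} {f : X → F} (hf : ContDiff ℝ 1 f)
    (h : ℝ) (x : X) :
    f (x + h • e) - f x = h • segAvg e (fun z => fderiv ℝ f z e) h x := by
  have hd : ∀ s ∈ uIcc (0 : ℝ) 1, HasDerivAt (fun s : ℝ => f (x + (s * h) • e))
      (h • fderiv ℝ f (x + (s * h) • e) e) s := by
    intro s _
    have h1 : HasDerivAt (fun s : ℝ => x + (s * h) • e) (h • e) s := by
      simpa using (((hasDerivAt_id s).mul_const h).smul_const e).const_add x
    have h2 := ((hf.differentiable (by norm_num)) (x + (s * h) • e)).hasFDerivAt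
    simpa [Function.comp_def] using h2.comp_hasDerivAt s h1
  have hc : Continuous fun z => fderiv ℝ f z e :=
    (hf.continuous_fderiv (by norm_num)).clm_apply continuous_const
  have := intervalIntegral.integral_eq_sub_of_hasDerivAt hd
    ((intervalIntegrable_segment hc h x).smul h)
  rw [intervalIntegral.integral_smul] at this
  simpa [segAvg] using this.symm

theorem segAvg_eq_zero {e : X} {f : X → F} {R : ℝ} (hf : ∀ x, R < ‖x‖ → f x = 0) {h : ℝ} {x : X}
    (hx : R + |h| * ‖e‖ < ‖x‖) : segAvg e f h x = 0 := by
  rw [segAvg, intervalIntegral.integral_congr (g := fun _ => 0), intervalIntegral.integral_zero]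
  intro s hs
  rw [uIcc_of_le zero_le_one] at hs
  apply hf
  have h1 : ‖(s * h) • e‖ ≤ |h| * ‖e‖ := by
    rw [norm_smul, Real.norm_eq_abs, abs_mul, abs_of_nonneg hs.1]
    gcongr
    nlinarith [abs_nonneg h, hs.2]
  have h2 : ‖x‖ ≤ ‖x + (s * h) • e‖ + ‖(s * h) • e‖ := by
    simpa using norm_sub_le (x + (s * h) • e) ((s * h) • e)
  linarith

theorem exists_norm_bound_of_hasCompactSupport {f : X → F} (hf : HasCompactSupport f) :
    ∃ R : ℝ, ∀ x, R < ‖x‖ → f x = 0 := by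
  obtain ⟨R, hR⟩ := hf.isBounded.exists_norm_le
  exact ⟨R, fun x hx => by_contra fun h => (hR x (subset_tsupport f h)).not_gt hx⟩

theorem hasCompactSupport_of_norm_bound [ProperSpace X] {f : X → F} {R : ℝ}
    (hf : ∀ x, R < ‖x‖ → f x = 0) : HasCompactSupport f :=
  HasCompactSupport.intro (isCompact_closedBall (0 : X) R) fun x hx => hf x (by simpa using hx)

theorem hasCompactSupport_segAvg [ProperSpace X] {e : X} {f : X → F} (hf : HasCompactSupport f)
    (h : ℝ) : HasCompactSupport (segAvg e f h) := by
  obtain ⟨R, hR⟩ := exists_norm_bound_of_hasCompactSupport hf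
  exact hasCompactSupport_of_norm_bound fun x hx => segAvg_eq_zero hR hx

theorem hasCompactSupport_comp_add_right {f : X → F} (hf : HasCompactSupport f) (v : X) :
    HasCompactSupport fun x => f (x + v) :=
  hf.comp_homeomorph (Homeomorph.addRight v)

variable [MeasurableSpace X] [BorelSpace X] [FiniteDimensional ℝ X]
  (μ : Measure X) [μ.IsAddHaarMeasure]

/-- Backward and forward averages are adjoint, by Fubini and the translation x ↦ x + s h e. This is
what moves an average off the second difference quotients, so that Young's inequality can be applied
at the same point as monotonicity. -/
theorem integral_mul_segAvg_neg {e : X} {f g : X → ℝ} (hf : Continuous f) (hg : Continuous g)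
    (hfc : HasCompactSupport f) (h : ℝ) :
    ∫ x, f x * segAvg e g (-h) x ∂μ = ∫ x, segAvg e f h x * g x ∂μ := by
  have : ProperSpace X := FiniteDimensional.proper ℝ X
  have l : ∀ x, f x * segAvg e g (-h) x
      = ∫ s in (0 : ℝ)..1, f x * g (x + (s * -h) • e) := fun x => by
    rw [segAvg, intervalIntegral.integral_const_mul]
  have r : ∀ x, segAvg e f h x * g x
      = ∫ s in (0 : ℝ)..1, f (x + (s * h) • e) * g x := fun x => by
    rw [segAvg, intervalIntegral.integral_mul_const]
  obtain ⟨R, hR⟩ := exists_norm_bound_of_hasCompactSupport hfc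
  -- Fubini is applied to a continuous integrand living on a compact box, where integrability is
  -- automatic.
  have swap : ∀ F : X → ℝ → ℝ, Continuous (Function.uncurry F) →
      (∃ R, ∀ s ∈ Ioc (0 : ℝ) 1, ∀ x, R < ‖x‖ → F x s = 0) →
      ∫ x, (∫ s in (0 : ℝ)..1, F x s) ∂μ = ∫ s in (0 : ℝ)..1, ∫ x, F x s ∂μ := by
    rintro F hF ⟨R, hR⟩
    simp_rw [intervalIntegral.integral_of_le zero_le_one]
    apply integral_integral_swap
    have h1 : Integrable (Function.uncurry F)
        ((μ.restrict (Metric.closedBall 0 R)).prod (volume.restrict (Ioc (0 : ℝ) 1))) := by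
      rw [Measure.prod_restrict]
      exact (hF.continuousOn.integrableOn_compact
        ((isCompact_closedBall (0 : X) R).prod (isCompact_Icc (a := (0 : ℝ)) (b := 1)))).mono_set
        (prod_mono_right Ioc_subset_Icc_self)
    rw [Measure.prod_restrict] at h1
    have h2 : μ.prod (volume.restrict (Ioc (0 : ℝ) 1))
        = (μ.prod volume).restrict (univ ×ˢ Ioc (0 : ℝ) 1) := by
      rw [← Measure.prod_restrict, Measure.restrict_univ]
    rw [h2]
    refine IntegrableOn.of_forall_sdiff_eq_zero h1 (MeasurableSet.univ.prod measurableSet_Ioc) ?_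
    rintro ⟨x, s⟩ ⟨⟨-, hs⟩, hx⟩
    refine hR s hs x (not_le.1 fun hx' => hx ⟨by simpa using hx', hs⟩)
  simp_rw [l, r]
  rw [swap (fun x s => f x * g (x + (s * -h) • e)) (by fun_prop)
      ⟨R, fun s _ x hx => by simp [hR x hx]⟩,
    swap (fun x s => f (x + (s * h) • e) * g x) (by fun_prop)
      ⟨R + |h| * ‖e‖, fun s hs x hx => ?_⟩]
  · congr 1
    ext s
    rw [← integral_add_right_eq_self (fun x => f x * g (x + (s * -h) • e)) ((s * h) • e)]
    congr 1
    ext x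
    rw [add_assoc, ← add_smul, mul_neg, add_neg_cancel, zero_smul, add_zero]
  · have h1 : ‖(s * h) • e‖ ≤ |h| * ‖e‖ := by
      rw [norm_smul, Real.norm_eq_abs, abs_mul, abs_of_nonneg hs.1.le]
      gcongr
      nlinarith [abs_nonneg h, hs.2]
    have h2 : ‖x‖ ≤ ‖x + (s * h) • e‖ + ‖(s * h) • e‖ := by
      simpa using norm_sub_le (x + (s * h) • e) ((s * h) • e)
    rw [hR _ (by linarith), zero_mul]

end SegAvg

/-! ### Difference quotients and weak limits -/

section DiffQuot

set_option linter.unusedSectionVars false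

variable {X F : Type*} [NormedAddCommGroup X] [NormedSpace ℝ X]
  [NormedAddCommGroup F] [NormedSpace ℝ F]

/-- The difference quotient of `f` at `x` with increment `h • e`. -/
def diffQuot (e : X) (h : ℝ) (f : X → F) (x : X) : F := h⁻¹ • (f (x + h • e) - f x)

theorem continuous_diffQuot {e : X} {f : X → F} (hf : Continuous f) (h : ℝ) :
    Continuous (diffQuot e h f) := by
  unfold diffQuot; fun_prop

theorem hasCompactSupport_diffQuot {e : X} {f : X → F} (hf : HasCompactSupport f) (h : ℝ) :
    HasCompactSupport (diffQuot e h f) :=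
  ((hasCompactSupport_comp_add_right hf (h • e)).sub hf).smul_left (f := fun _ => h⁻¹)

theorem contDiff_diffQuot {e : X} {f : X → F} {j : WithTop ℕ∞} (hf : ContDiff ℝ j f) (h : ℝ) :
    ContDiff ℝ j (diffQuot e h f) := by
  unfold diffQuot; fun_prop

theorem fderiv_diffQuot {e : X} {f : X → F} (hf : Differentiable ℝ f) (h : ℝ) (x v : X) :
    fderiv ℝ (diffQuot e h f) x v = diffQuot e h (fun z => fderiv ℝ f z v) x := by
  have h1 : HasFDerivAt (fun x => f (x + h • e)) (fderiv ℝ f (x + h • e)) x :=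
    (hasFDerivAt_comp_add_right _).2 (hf _).hasFDerivAt
  have := (h1.sub (hf x).hasFDerivAt).const_smul h⁻¹
  have h2 : HasFDerivAt (diffQuot e h f) (h⁻¹ • (fderiv ℝ f (x + h • e) - fderiv ℝ f x)) x := this
  rw [h2.fderiv]
  simp [diffQuot]

theorem diffQuot_eq_segAvg [CompleteSpace F] {e : X} {f : X → F} (hf : ContDiff ℝ 1 f)
    {h : ℝ} (hh : h ≠ 0) (x : X) :
    diffQuot e h f x = segAvg e (fun z => fderiv ℝ f z e) h x := by
  rw [diffQuot, sub_eq_smul_segAvg hf, smul_smul, inv_mul_cancel₀ hh, one_smul]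

theorem norm_diffQuot_le [CompleteSpace F] {e : X} {f : X → F} (hf : ContDiff ℝ 1 f)
    {h : ℝ} (hh : h ≠ 0) {b : X → ℝ} (hb : Continuous b) (hfb : ∀ z, ‖fderiv ℝ f z e‖ ≤ b z)
    (x : X) : ‖diffQuot e h f x‖ ≤ segAvg e b h x := by
  rw [diffQuot_eq_segAvg hf hh]
  refine (norm_segAvg_le _ _ _ _).trans (segAvg_mono ?_ hb hfb h x)
  exact ((hf.continuous_fderiv (by norm_num)).clm_apply continuous_const).norm

/-- In the discrete Leibniz rule one factor is evaluated at the shifted point; this is the origin of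
the arguments x - h e in the estimates below. -/
theorem diffQuot_smul (e : X) (h : ℝ) (c : X → ℝ) (f : X → F) (x : X) :
    diffQuot e h (fun z => c z • f z) x =
      diffQuot e h c x • f (x + h • e) + c x • diffQuot e h f x := by
  simp only [diffQuot, smul_eq_mul, smul_sub, sub_smul, smul_smul, mul_sub]
  rw [mul_comm (c x) h⁻¹]
  abel

variable [MeasurableSpace X] [BorelSpace X] [FiniteDimensional ℝ X]
  (μ : Measure X) [μ.IsAddHaarMeasure]

/-- Discrete integration by parts, a consequence of translation invariance. A general bilinear
pairing covers both the inner product (testing the equation) and scalar multiplication (weak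
derivatives). -/
theorem integral_bilin_diffQuot_neg {F' F'' : Type*} [NormedAddCommGroup F'] [NormedSpace ℝ F']
    [NormedAddCommGroup F''] [NormedSpace ℝ F''] (L : F →L[ℝ] F' →L[ℝ] F'')
    {e : X} {f : X → F} {g : X → F'} (hf : Continuous f) (hg : Continuous g)
    (hgc : HasCompactSupport g) (h : ℝ) :
    ∫ x, L (f x) (diffQuot e (-h) g x) ∂μ = -∫ x, L (diffQuot e h f x) (g x) ∂μ := by
  have : ProperSpace X := FiniteDimensional.proper ℝ X
  have hgc' : ∀ v : X, HasCompactSupport fun x => g (x + v) :=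
    hasCompactSupport_comp_add_right hgc
  have int : ∀ (a : X → F) (b : X → F'), Continuous a → Continuous b → HasCompactSupport b →
      Integrable (fun x => L (a x) (b x)) μ := fun a b ha hb hbc =>
    Continuous.integrable_of_hasCompactSupport (by fun_prop)
      (hbc.mono fun x hx => by
        contrapose! hx
        simp only [Function.mem_support, not_not] at hx ⊢
        simp [hx])
  have i0 := int f g hf hg hgc
  have i1 := int f (fun x => g (x + -h • e)) hf (by fun_prop) (hgc' _)
  have i2 := int (fun x => f (x + h • e)) g (by fun_prop) hg hgc
  have e1 : ∀ x, L (f x) (diffQuot e (-h) g x)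
      = -h⁻¹ • (L (f x) (g (x + -h • e)) - L (f x) (g x)) := fun x => by
    simp [diffQuot, inv_neg]
  have e2 : ∀ x, L (diffQuot e h f x) (g x)
      = h⁻¹ • (L (f (x + h • e)) (g x) - L (f x) (g x)) := fun x => by
    simp [diffQuot]
  simp_rw [e1, e2]
  rw [integral_smul, integral_smul, integral_sub i1 i0, integral_sub i2 i0, neg_smul]
  congr 3
  rw [← integral_add_right_eq_self _ (h • e)]
  simp

/-- Supports bounded uniformly for |h| ≤ 1 reduce the limit to continuity of a parametric integral
over one compact ball. -/
theorem tendsto_integral_of_hasCompactSupport {F : ℝ → X → ℝ} (hF : Continuous F.uncurry) {R : ℝ}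
    (hR : ∀ h x, |h| ≤ 1 → R < ‖x‖ → F h x = 0) :
    Filter.Tendsto (fun h => ∫ x, F h x ∂μ) (𝓝 0) (𝓝 (∫ x, F 0 x ∂μ)) := by
  have : ProperSpace X := FiniteDimensional.proper ℝ X
  have key : ∀ h : ℝ, |h| ≤ 1 → ∫ x in Metric.closedBall 0 R, F h x ∂μ = ∫ x, F h x ∂μ :=
    fun h hh => setIntegral_eq_integral_of_forall_compl_eq_zero fun x hx =>
      hR h x hh (by simpa using hx)
  have hc := (continuous_parametric_integral_of_continuous (μ := μ) hF
    (isCompact_closedBall (0 : X) R)).tendsto 0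
  rw [key 0 (by simp)] at hc
  refine hc.congr' ?_
  filter_upwards [Metric.closedBall_mem_nhds (0 : ℝ) one_pos] with h hh
  exact key h (by simpa using hh)

end DiffQuot

/-- Bounded nets in a Hilbert space have weak limit points. -/
theorem exists_weak_limit {ι H : Type*} [NormedAddCommGroup H] [InnerProductSpace ℝ H]
    [CompleteSpace H] {l : Filter ι} [l.NeBot] {f : ι → H} {B : ι → ℝ} {B₀ : ℝ}
    (hB : Filter.Tendsto B l (𝓝 B₀)) (hf : ∀ᶠ i in l, ‖f i‖ ^ 2 ≤ B i) :
    ∃ x : H, ‖x‖ ^ 2 ≤ B₀ ∧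
      ∀ y c, Filter.Tendsto (fun i => inner ℝ (f i) y) l (𝓝 c) → inner ℝ x y = c := by
  -- Along an ultrafilter, Banach–Alaoglu makes all pairings converge at once, with no subsequence
  -- and no separability.
  let U : Ultrafilter ι := Ultrafilter.of l
  have hU : (U : Filter ι) ≤ l := Ultrafilter.of_le l
  let T : ι → WeakDual ℝ H := fun i =>
    StrongDual.toWeakDual (InnerProductSpace.toDual ℝ H (f i))
  have hball : ∀ᶠ i in l,
      T i ∈ WeakDual.toStrongDual ⁻¹' Metric.closedBall (0 : StrongDual ℝ H) √(B₀ + 1) := by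
    filter_upwards [hf, hB.eventually (gt_mem_nhds (lt_add_one B₀))] with i h1 h2
    have : ‖f i‖ ≤ √(B₀ + 1) := Real.le_sqrt_of_sq_le (by linarith)
    simpa [T] using this
  obtain ⟨z, -, hz⟩ := (WeakDual.isCompact_closedBall (𝕜 := ℝ) (E := H) 0 √(B₀ + 1))
    |>.ultrafilter_le_nhds (U.map T) (by
      rw [Ultrafilter.coe_map, Filter.le_principal_iff]
      exact hU hball)
  let x : H := (InnerProductSpace.toDual ℝ H).symm (WeakDual.toStrongDual z)
  have hx : ∀ y, Filter.Tendsto (fun i => inner ℝ (f i) y) U (𝓝 (inner ℝ x y)) := by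
    intro y
    have h1 : Filter.Tendsto (fun i => T i y) U (𝓝 (z y)) :=
      ((WeakDual.eval_continuous y).tendsto z).comp (hz : Filter.Tendsto T U (𝓝 z))
    have h2 : inner ℝ x y = z y := by
      simp only [x, InnerProductSpace.toDual_symm_apply]
      rfl
    rw [h2]
    exact h1
  refine ⟨x, ?_, fun y c hc => tendsto_nhds_unique (hx y) (hc.mono_left hU)⟩
  -- Lower semicontinuity of the norm: 2⟨f i, x⟩ ≤ ‖f i‖² + ‖x‖² ≤ B i + ‖x‖², and the left side
  -- tends to 2‖x‖².
  have h1 := le_of_tendsto_of_tendsto (hx x)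
    (((hB.mono_left hU).add_const (‖x‖ ^ 2)).div_const 2) (by
      filter_upwards [hU hf] with i hi
      have := real_inner_le_norm (f i) x
      nlinarith [sq_nonneg (‖f i‖ - ‖x‖)])
  rw [real_inner_self_eq_norm_sq] at h1
  linarith

/-! ### Weak derivatives from bounded difference quotients -/

section WeakDerivative

variable {X Y : Type*} [NormedAddCommGroup X] [NormedSpace ℝ X] [MeasurableSpace X] [BorelSpace X]
  [FiniteDimensional ℝ X] (μ : Measure X) [μ.IsAddHaarMeasure]
  [NormedAddCommGroup Y] [InnerProductSpace ℝ Y] [CompleteSpace Y]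

/-- Uniform `L²` bounds on difference quotients give a weak derivative in `L²`. -/
theorem exists_weak_deriv_of_diffQuot_bound {e : X} {v : X → Y} (hv : Continuous v)
    (hvc : HasCompactSupport v) {η : X → ℝ} (hη : Continuous η) {B : ℝ → ℝ} {B₀ : ℝ}
    (hB : Filter.Tendsto B (𝓝[>] 0) (𝓝 B₀))
    (hvB : ∀ᶠ h in 𝓝[>] 0, ∫ x, ‖η x • diffQuot e h v x‖ ^ 2 ∂μ ≤ B h) :
    ∃ w : X → Y, MemLp w 2 μ ∧ ∫ x, ‖w x‖ ^ 2 ∂μ ≤ B₀ ∧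
      ∀ φ : X → ℝ, ContDiff ℝ 1 φ → HasCompactSupport φ → (∀ x, φ x ≠ 0 → η x = 1) →
        ∫ x, fderiv ℝ φ x e • v x ∂μ = -∫ x, φ x • w x ∂μ := by
  have : ProperSpace X := FiniteDimensional.proper ℝ X
  have hfL : ∀ h, MemLp (fun x => η x • diffQuot e h v x) 2 μ := fun h =>
    (hη.smul (continuous_diffQuot hv h)).memLp_of_hasCompactSupport
      ((hasCompactSupport_diffQuot hvc h).smul_left (f := η))
  have hnorm : ∀ w : X → Y, ∀ hw : MemLp w 2 μ, ‖hw.toLp w‖ ^ 2 = ∫ x, ‖w x‖ ^ 2 ∂μ := by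
    intro w hw
    rw [← real_inner_self_eq_norm_sq, L2.inner_def]
    refine integral_congr_ae ?_
    filter_upwards [hw.coeFn_toLp] with x hx
    rw [hx, real_inner_self_eq_norm_sq]
  obtain ⟨w, hwB, hw⟩ := exists_weak_limit (f := fun h => (hfL h).toLp _) hB
    (by simpa only [hnorm] using hvB)
  have hwL : MemLp w 2 μ := Lp.memLp w
  refine ⟨w, hwL, ?_, fun φ hφ hφc hφη => ?_⟩
  · rwa [← hnorm _ hwL, Lp.toLp_coeFn]
  have hφ' : Continuous fun x => fderiv ℝ φ x e :=
    (hφ.continuous_fderiv (by norm_num)).clm_apply continuous_const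
  have hφL : MemLp φ 2 μ := hφ.continuous.memLp_of_hasCompactSupport hφc
  have iw : Integrable (fun x => φ x • w x) μ := memLp_one_iff_integrable.1 (hwL.smul hφL)
  have iv : Integrable (fun x => fderiv ℝ φ x e • v x) μ :=
    (hφ'.smul hv).integrable_of_hasCompactSupport hvc.smul_left
  refine ext_inner_left ℝ fun y => ?_
  have hyL : MemLp (fun x => φ x • y) 2 μ :=
    (hφ.continuous.smul continuous_const).memLp_of_hasCompactSupport
      (hφc.smul_right (f' := fun _ => y))
  -- Pairing the weak limit with φ • y, for a constant vector y, yields the vector-valued identity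
  -- tested against y. The limit of the pairings is found by moving the quotient onto φ, where it is
  -- a segment average of ∂φ.
  have hlim := hw (hyL.toLp _) (-inner ℝ y (∫ x, fderiv ℝ φ x e • v x ∂μ)) ?_
  · rw [inner_neg_right, ← integral_inner iw, eq_neg_iff_add_eq_zero, add_comm,
      ← eq_neg_iff_add_eq_zero, ← hlim, L2.inner_def]
    refine integral_congr_ae ?_
    filter_upwards [hyL.coeFn_toLp] with x hx
    rw [hx, real_inner_smul_right, real_inner_smul_right, real_inner_comm]
  · have hF : Filter.Tendsto (fun h => -∫ x, inner ℝ y (segAvg e (fun z => fderiv ℝ φ z e) (-h) x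
        • v x) ∂μ) (𝓝[>] 0) (𝓝 (-inner ℝ y (∫ x, fderiv ℝ φ x e • v x ∂μ))) := by
      obtain ⟨R, hR⟩ := exists_norm_bound_of_hasCompactSupport hvc
      have := tendsto_integral_of_hasCompactSupport μ (R := R)
        (F := fun h x => inner ℝ y (segAvg e (fun z => fderiv ℝ φ z e) (-h) x • v x)) (by
          refine Continuous.inner continuous_const (Continuous.smul ?_ (hv.comp continuous_snd))
          exact continuous_segAvg hφ' continuous_fst.neg continuous_snd)
        (fun h x _ hx => by simp [hR x hx])
      simp only [neg_zero, segAvg_zero] at this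
      rw [integral_inner iv] at this
      exact this.neg.mono_left nhdsWithin_le_nhds
    refine hF.congr' ?_
    filter_upwards [self_mem_nhdsWithin] with h hh
    have hh0 : -h ≠ 0 := neg_ne_zero.2 (ne_of_gt hh)
    have i1 : Integrable (fun x => diffQuot e (-h) φ x • v x) μ :=
      ((continuous_diffQuot hφ.continuous _).smul hv).integrable_of_hasCompactSupport
        hvc.smul_left
    have i2 : Integrable (fun x => φ x • diffQuot e h v x) μ :=
      (hφ.continuous.smul (continuous_diffQuot hv h)).integrable_of_hasCompactSupport
        (hφc.smul_right)
    have hparts := integral_bilin_diffQuot_neg μ (ContinuousLinearMap.lsmul ℝ ℝ (E := Y)).flip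
      (e := e) hv hφ.continuous hφc h
    simp only [ContinuousLinearMap.flip_apply, ContinuousLinearMap.lsmul_apply] at hparts
    simp_rw [← diffQuot_eq_segAvg hφ hh0]
    rw [integral_inner i1, hparts, inner_neg_right, neg_neg, ← integral_inner i2, L2.inner_def]
    refine integral_congr_ae ?_
    filter_upwards [hyL.coeFn_toLp, (hfL h).coeFn_toLp] with x hx hx'
    rw [hx, hx', real_inner_smul_right, real_inner_smul_right, real_inner_smul_left,
      real_inner_comm]
    rcases eq_or_ne (φ x) 0 with h0 | h0
    · simp [h0]
    · rw [hφη x h0, one_mul]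

end WeakDerivative

/-! ### Gradients as vectors -/

section Gradient

variable {n k : ℕ}

/-- The space of gradients of maps `ℝⁿ → ℝᵏ`. -/
abbrev GradSpace (n k : ℕ) : Type := PiLp 2 fun _ : Fin n => Euc k

/-- The gradient of a map `ℝⁿ → ℝᵏ`. -/
def grad (u : Euc n → Euc k) (x : Euc n) : GradSpace n k :=
  WithLp.toLp 2 fun α => partialDeriv α u x

/-- The gradient of a scalar function. -/
def scalarGrad (η : Euc n → ℝ) (x : Euc n) : Euc n := WithLp.toLp 2 fun α => partialDeriv α η x

/-- The tensor product of two vectors. -/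
def tensor (c : Euc n) (y : Euc k) : GradSpace n k := WithLp.toLp 2 fun α => c α • y

theorem norm_grad (u : Euc n → Euc k) (x : Euc n) : ‖grad u x‖ = gradNorm u x := by
  simp [PiLp.norm_eq_of_L2, grad, gradNorm]

theorem inner_grad (u v : Euc n → Euc k) (x : Euc n) :
    inner ℝ (grad u x) (grad v x) = ∑ α, inner ℝ (partialDeriv α u x) (partialDeriv α v x) := by
  simp [PiLp.inner_apply, grad]

theorem norm_partialDeriv_le (u : Euc n → Euc k) (α : Fin n) (x : Euc n) :
    ‖partialDeriv α u x‖ ≤ ‖grad u x‖ :=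
  PiLp.norm_apply_le (grad u x) α

theorem norm_partialDeriv_le_scalarGrad (η : Euc n → ℝ) (α : Fin n) (x : Euc n) :
    ‖partialDeriv α η x‖ ≤ ‖scalarGrad η x‖ :=
  PiLp.norm_apply_le (scalarGrad η x) α

theorem norm_tensor (c : Euc n) (y : Euc k) : ‖tensor c y‖ = ‖c‖ * ‖y‖ := by
  rw [PiLp.norm_eq_of_L2, EuclideanSpace.norm_eq, ← Real.sqrt_sq (norm_nonneg y),
    ← Real.sqrt_mul (by positivity), Finset.sum_mul]
  simp [tensor, norm_smul, mul_pow]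

theorem continuous_tensor {Z : Type*} [TopologicalSpace Z] {c : Z → Euc n} {y : Z → Euc k}
    (hc : Continuous c) (hy : Continuous y) : Continuous fun z => tensor (c z) (y z) := by
  unfold tensor; fun_prop

theorem continuous_partialDeriv {F : Type*} [NormedAddCommGroup F] [NormedSpace ℝ F]
    {f : Euc n → F} (hf : ContDiff ℝ 1 f) (α : Fin n) : Continuous (partialDeriv α f) :=
  (hf.continuous_fderiv (by norm_num)).clm_apply continuous_const

theorem hasCompactSupport_partialDeriv {F : Type*} [NormedAddCommGroup F] [NormedSpace ℝ F]
    {f : Euc n → F} (hf : HasCompactSupport f) (α : Fin n) :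
    HasCompactSupport (partialDeriv α f) :=
  hf.fderiv_apply ℝ (EuclideanSpace.single α 1)

theorem continuous_grad {u : Euc n → Euc k} (hu : ContDiff ℝ 1 u) : Continuous (grad u) := by
  have := fun α => continuous_partialDeriv hu α
  unfold grad; fun_prop

theorem hasCompactSupport_grad {u : Euc n → Euc k} (hu : HasCompactSupport u) :
    HasCompactSupport (grad u) := by
  refine (hu.fderiv ℝ).mono fun x hx => ?_
  contrapose! hx
  simp only [Function.mem_support, not_not] at hx ⊢
  ext α
  simp [grad, partialDeriv, hx]

theorem contDiff_scalarGrad {η : Euc n → ℝ} (hη : ContDiff ℝ 2 η) :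
    ContDiff ℝ 1 (scalarGrad η) := by
  have : ∀ α, ContDiff ℝ 1 (partialDeriv α η) := fun α =>
    (hη.fderiv_right (m := 1) (by norm_num)).clm_apply contDiff_const
  unfold scalarGrad; fun_prop

theorem hasCompactSupport_scalarGrad {η : Euc n → ℝ} (hη : HasCompactSupport η) :
    HasCompactSupport (scalarGrad η) := by
  refine (hη.fderiv ℝ).mono fun x hx => ?_
  contrapose! hx
  simp only [Function.mem_support, not_not] at hx ⊢
  ext α
  simp [scalarGrad, partialDeriv, hx]

theorem grad_smul {η : Euc n → ℝ} {y : Euc n → Euc k} (hη : Differentiable ℝ η)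
    (hy : Differentiable ℝ y) (x : Euc n) :
    grad (fun z => η z • y z) x = η x • grad y x + tensor (scalarGrad η x) (y x) := by
  ext α : 1
  simp [grad, scalarGrad, tensor, partialDeriv, fderiv_fun_smul (hη x) (hy x)]

theorem grad_diffQuot {e : Euc n} {u : Euc n → Euc k} (hu : Differentiable ℝ u) (h : ℝ)
    (x : Euc n) : grad (diffQuot e h u) x = diffQuot e h (grad u) x := by
  ext α : 1
  simp only [grad, partialDeriv, fderiv_diffQuot hu]
  simp [diffQuot, grad, partialDeriv]

theorem diffQuot_tensor (e : Euc n) (h : ℝ) (c : Euc n → Euc n) (y : Euc n → Euc k) (x : Euc n) :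
    diffQuot e h (fun z => tensor (c z) (y z)) x =
      tensor (diffQuot e h c x) (y (x + h • e)) + tensor (c x) (diffQuot e h y x) := by
  ext α : 1
  have := diffQuot_smul e h (fun z => c z α) y x
  simpa [diffQuot, tensor] using this

end Gradient

/-! ### The difference quotient estimate -/

section Estimate

theorem integrable_of_support_subset {X F F' : Type*} [TopologicalSpace X] [MeasurableSpace X]
    [OpensMeasurableSpace X] {μ : Measure X} [IsFiniteMeasureOnCompacts μ] [NormedAddCommGroup F]
    [Zero F'] {f : X → F} {g : X → F'} (hf : Continuous f) (hg : HasCompactSupport g)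
    (hfg : ∀ x, g x = 0 → f x = 0) : Integrable f μ :=
  hf.integrable_of_hasCompactSupport (hg.mono fun x hx hgx => hx (hfg x hgx))

variable {n k : ℕ} {p : ℝ} {u : Euc n → Euc k} {η : Euc n → ℝ} {e : Euc n} {h : ℝ}

theorem integral_inner_diffQuot_neg {F : Type*} [NormedAddCommGroup F] [InnerProductSpace ℝ F]
    {f g : Euc n → F} (hf : Continuous f) (hg : Continuous g) (hgc : HasCompactSupport g) :
    ∫ x, inner ℝ (f x) (diffQuot e (-h) g x) = -∫ x, inner ℝ (diffQuot e h f x) (g x) :=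
  integral_bilin_diffQuot_neg volume (innerSL ℝ) hf hg hgc h

/-- The gradient of the test map is D_{-h} of η² D_h ∇u + 2 ∇η ⊗ η D_h u. Integration by parts is
used on the first summand, to reach the monotone expression. The second keeps its quotient, so that
the field V(∇u) enters there without being differenced. -/
theorem integral_inner_diffQuot_pField (hp : 1 < p) (hu : ContDiff ℝ 1 u)
    (hη : ContDiff ℝ 2 η) (hηc : HasCompactSupport η) :
    ∫ x, η x ^ 2 * inner ℝ (diffQuot e h (fun z => pField p (grad u z)) x)
        (diffQuot e h (grad u) x) =
      -(∫ x, inner ℝ (pField p (grad u x))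
        (grad (diffQuot e (-h) fun z => η z • η z • diffQuot e h u z) x)) +
      2 * ∫ x, inner ℝ (pField p (grad u x))
        (diffQuot e (-h) (fun z => tensor (scalarGrad η z) (η z • diffQuot e h u z)) x) := by
  have hη1 : ContDiff ℝ 1 η := hη.of_le (by norm_num)
  have hDu : ContDiff ℝ 1 (diffQuot e h u) := contDiff_diffQuot hu h
  have hy : ContDiff ℝ 1 fun z => η z • diffQuot e h u z := hη1.smul hDu
  have hψ : ContDiff ℝ 1 fun z => η z • η z • diffQuot e h u z := hη1.smul hy
  have hV : Continuous fun z => pField p (grad u z) :=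
    (continuous_pField hp).comp (continuous_grad hu)
  have hDV : Continuous (diffQuot e h fun z => pField p (grad u z)) := continuous_diffQuot hV h
  have hDg : Continuous (diffQuot e h (grad u)) := continuous_diffQuot (continuous_grad hu) h
  have hW : Continuous fun z => tensor (scalarGrad η z) (η z • diffQuot e h u z) :=
    continuous_tensor (contDiff_scalarGrad hη).continuous hy.continuous
  have hWc : HasCompactSupport fun z => tensor (scalarGrad η z) (η z • diffQuot e h u z) := by
    refine hηc.mono fun x hx => ?_
    contrapose! hx
    simp only [Function.mem_support, not_not] at hx ⊢
    ext α
    simp [tensor, hx]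
  have hψc : HasCompactSupport fun z => η z • η z • diffQuot e h u z := hηc.smul_right
  have hgψ : ∀ x, grad (fun z => η z • η z • diffQuot e h u z) x =
      η x ^ 2 • diffQuot e h (grad u) x +
        (2 : ℝ) • tensor (scalarGrad η x) (η x • diffQuot e h u x) := by
    intro x
    have ht : η x • tensor (scalarGrad η x) (diffQuot e h u x)
        = tensor (scalarGrad η x) (η x • diffQuot e h u x) := by
      ext α : 1
      simp [tensor, smul_smul, mul_comm]
    rw [grad_smul (hη1.differentiable (by norm_num)) (hy.differentiable (by norm_num)),
      grad_smul (hη1.differentiable (by norm_num)) (hDu.differentiable (by norm_num)),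
      grad_diffQuot (hu.differentiable (by norm_num)), smul_add, ht, smul_smul, ← sq, two_smul,
      add_assoc]
  simp_rw [grad_diffQuot (hψ.differentiable (by norm_num))]
  rw [integral_inner_diffQuot_neg hV (continuous_grad hψ) (hasCompactSupport_grad hψc),
    integral_inner_diffQuot_neg hV hW hWc, neg_neg, mul_neg, ← integral_const_mul, ← sub_eq_add_neg, ← integral_sub]
  · congr 1
    ext x
    rw [hgψ, inner_add_right, real_inner_smul_right, real_inner_smul_right]
    ring
  · exact integrable_of_support_subset (hDV.inner (continuous_grad hψ))
      (hasCompactSupport_grad hψc) fun x hx => by rw [hx, inner_zero_right]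
  · exact integrable_of_support_subset (continuous_const.mul (hDV.inner hW)) hWc
      fun x hx => by rw [hx, inner_zero_right, mul_zero]

variable {β : Fin n} {τ σ : ℝ}

local notation "e[" b "]" => EuclideanSpace.single b (1 : ℝ)

theorem norm_cutoff_diffQuot_shift_le (hu : ContDiff ℝ 1 u) (hη0 : ∀ x, 0 ≤ η x) (hh : h ≠ 0)
    (x : Euc n) :
    ‖η x • diffQuot e[β] h u x‖ ≤ η x * segAvg e[β] (fun z => ‖grad u z‖) h x := by
  rw [norm_smul, Real.norm_of_nonneg (hη0 x)]
  exact mul_le_mul_of_nonneg_left (norm_diffQuot_le hu hh (continuous_grad hu).norm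
    (fun z => norm_partialDeriv_le u β z) x) (hη0 x)

/-- The outer quotient is an average of the derivative ∂η D_h u + η D_h ∂u, and D_h u in turn is an
average of ∂u. Second differences appear only as η D_h ∇u, the quantity that can be absorbed. -/
theorem norm_diffQuot_neg_cutoff_diffQuot_le (hu : ContDiff ℝ 1 u) (hη : ContDiff ℝ 2 η)
    (hτ : ∀ x, ‖scalarGrad η x‖ ≤ τ) (hh : h ≠ 0) (x : Euc n) :
    ‖diffQuot e[β] (-h) (fun z => η z • diffQuot e[β] h u z) x‖ ≤
      τ * segAvg e[β] (segAvg e[β] (fun z => ‖grad u z‖) h) (-h) x +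
        segAvg e[β] (fun z => ‖η z • diffQuot e[β] h (grad u) z‖) (-h) x := by
  have hη1 : ContDiff ℝ 1 η := hη.of_le (by norm_num)
  have hDu : ContDiff ℝ 1 (diffQuot e[β] h u) := contDiff_diffQuot hu h
  have hG := (continuous_grad hu).norm
  have hAG : Continuous (segAvg e[β] (fun z => ‖grad u z‖) h) :=
    continuous_segAvg hG continuous_const continuous_id
  have hg : Continuous fun z => ‖η z • diffQuot e[β] h (grad u) z‖ :=
    (hη.continuous.smul (continuous_diffQuot (continuous_grad hu) h)).norm
  rw [← segAvg_const_mul, ← segAvg_add (f := fun z => τ * _) (continuous_const.mul hAG) hg]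
  refine norm_diffQuot_le (hη1.smul hDu) (neg_ne_zero.2 hh) ((continuous_const.mul hAG).add hg)
    (fun z => ?_) x
  have : fderiv ℝ (fun z => η z • diffQuot e[β] h u z) z e[β]
      = partialDeriv β η z • diffQuot e[β] h u z + η z • partialDeriv β (diffQuot e[β] h u) z := by
    rw [fderiv_fun_smul (hη1.differentiable (by norm_num) z) (hDu.differentiable (by norm_num) z)]
    simp [partialDeriv, add_comm]
  refine (congrArg norm this).le.trans ((norm_add_le _ _).trans (add_le_add ?_ ?_))
  · rw [norm_smul]
    exact mul_le_mul ((norm_partialDeriv_le_scalarGrad η β z).trans (hτ z))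
      (norm_diffQuot_le hu hh hG (fun z => norm_partialDeriv_le u β z) z) (norm_nonneg _)
      ((norm_nonneg _).trans (hτ z))
  · beta_reduce
    rw [norm_smul, norm_smul, ← grad_diffQuot (hu.differentiable (by norm_num))]
    exact mul_le_mul_of_nonneg_left (norm_partialDeriv_le _ β z) (norm_nonneg _)

/-- Splitting η² as η · (η D_h u) leaves one factor η attached to the second differences after the
other has served in the product rule. -/
theorem norm_testFunction_le (hu : ContDiff ℝ 1 u) (hη : ContDiff ℝ 2 η)
    (hη0 : ∀ x, 0 ≤ η x) (hτ : ∀ x, ‖scalarGrad η x‖ ≤ τ) (hh : h ≠ 0) (x : Euc n) :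
    ‖diffQuot e[β] (-h) (fun z => η z • η z • diffQuot e[β] h u z) x‖ ≤
      τ * (η (x + -h • e[β]) * segAvg e[β] (fun z => ‖grad u z‖) h (x + -h • e[β])) +
      η x * (τ * segAvg e[β] (segAvg e[β] (fun z => ‖grad u z‖) h) (-h) x +
        segAvg e[β] (fun z => ‖η z • diffQuot e[β] h (grad u) z‖) (-h) x) := by
  rw [diffQuot_smul]
  refine (norm_add_le _ _).trans (add_le_add ?_ ?_)
  · rw [norm_smul]
    refine mul_le_mul ?_ (norm_cutoff_diffQuot_shift_le hu hη0 hh _) (norm_nonneg _)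
      ((norm_nonneg _).trans (hτ x))
    have := norm_diffQuot_le (e := e[β]) (b := fun _ => τ) (hη.of_le (by norm_num))
      (neg_ne_zero.2 hh) continuous_const
      (fun z => (norm_partialDeriv_le_scalarGrad η β z).trans (hτ z)) x
    rwa [segAvg_const] at this
  · rw [norm_smul, Real.norm_of_nonneg (hη0 x)]
    exact mul_le_mul_of_nonneg_left
      (norm_diffQuot_neg_cutoff_diffQuot_le hu hη hτ hh x) (hη0 x)

theorem norm_diffQuot_neg_tensor_le (hu : ContDiff ℝ 1 u) (hη : ContDiff ℝ 2 η)
    (hη0 : ∀ x, 0 ≤ η x) (hτ : ∀ x, ‖scalarGrad η x‖ ≤ τ)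
    (hσ : ∀ x, ‖fderiv ℝ (scalarGrad η) x e[β]‖ ≤ σ) (hh : h ≠ 0) (x : Euc n) :
    ‖diffQuot e[β] (-h) (fun z => tensor (scalarGrad η z) (η z • diffQuot e[β] h u z)) x‖ ≤
      σ * (η (x + -h • e[β]) * segAvg e[β] (fun z => ‖grad u z‖) h (x + -h • e[β])) +
      ‖scalarGrad η x‖ * (τ * segAvg e[β] (segAvg e[β] (fun z => ‖grad u z‖) h) (-h) x +
        segAvg e[β] (fun z => ‖η z • diffQuot e[β] h (grad u) z‖) (-h) x) := by
  rw [diffQuot_tensor]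
  refine (norm_add_le _ _).trans (add_le_add ?_ ?_)
  · rw [norm_tensor]
    refine mul_le_mul ?_ (norm_cutoff_diffQuot_shift_le hu hη0 hh _) (norm_nonneg _)
      ((norm_nonneg _).trans (hσ x))
    have := norm_diffQuot_le (e := e[β]) (b := fun _ => σ) (contDiff_scalarGrad hη)
      (neg_ne_zero.2 hh) continuous_const hσ x
    rwa [segAvg_const] at this
  · rw [norm_tensor]
    exact mul_le_mul_of_nonneg_left
      (norm_diffQuot_neg_cutoff_diffQuot_le hu hη hτ hh x) (norm_nonneg _)

end Estimate

/-! ### Absorbing the second difference quotients -/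

section Absorption

variable {n k : ℕ} {p Λ M : ℝ} {u : Euc n → Euc k} {η : Euc n → ℝ} {h : ℝ}
  {β : Fin n} {τ σ : ℝ}

local notation "e[" b "]" => EuclideanSpace.single b (1 : ℝ)

/-- The factor multiplying second difference quotients in the tested equation. -/
def hessianLoad (p Λ : ℝ) (u : Euc n → Euc k) (η : Euc n → ℝ) (x : Euc n) : ℝ :=
  2 * ‖grad u x‖ ^ (p - 1) * ‖scalarGrad η x‖ + Λ * ‖grad u x‖ ^ p * η x

/-- The first order terms in the tested equation. -/
def firstOrderLoad (p Λ τ σ : ℝ) (u : Euc n → Euc k) (η : Euc n → ℝ) (β : Fin n) (h : ℝ)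
    (x : Euc n) : ℝ :=
  (2 * σ * ‖grad u x‖ ^ (p - 1) + Λ * τ * ‖grad u x‖ ^ p) *
      (η (x + -h • e[β]) * segAvg e[β] (fun z => ‖grad u z‖) h (x + -h • e[β])) +
    τ * (hessianLoad p Λ u η x * segAvg e[β] (segAvg e[β] (fun z => ‖grad u z‖) h) (-h) x)

/-- The Young remainder of the terms containing second difference quotients. -/
def youngLoad (p Λ : ℝ) (u : Euc n → Euc k) (η : Euc n → ℝ) (β : Fin n) (h : ℝ)
    (x : Euc n) : ℝ :=
  (‖grad u x‖ + ‖grad u (x + h • e[β])‖ + h) ^ (2 - p) * segAvg e[β] (hessianLoad p Λ u η) h x ^ 2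

/-- The bound for the difference quotients of the gradient. -/
def diffQuotBound (p Λ τ σ M : ℝ) (u : Euc n → Euc k) (η : Euc n → ℝ) (β : Fin n) (h : ℝ) : ℝ :=
  (2 * M + h) ^ (2 - p) * (2 / (p - 1) * ((2 * (p - 1))⁻¹ * (∫ x, youngLoad p Λ u η β h x) +
    ∫ x, firstOrderLoad p Λ τ σ u η β h x))

theorem continuous_rpow_norm_grad (hu : ContDiff ℝ 1 u) {s : ℝ} (hs : 0 ≤ s) :
    Continuous fun x => ‖grad u x‖ ^ s :=
  (continuous_grad hu).norm.rpow_const fun _ => Or.inr hs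

theorem continuous_hessianLoad (hp : 1 < p) (hu : ContDiff ℝ 1 u) (hη : ContDiff ℝ 2 η) :
    Continuous (hessianLoad p Λ u η) := by
  have h1 := continuous_rpow_norm_grad hu (by linarith : 0 ≤ p - 1)
  have h2 := continuous_rpow_norm_grad hu (by linarith : 0 ≤ p)
  have h3 := (contDiff_scalarGrad hη).continuous
  have h4 := hη.continuous
  unfold hessianLoad
  fun_prop

theorem hasCompactSupport_hessianLoad (hp : 1 < p) (huc : HasCompactSupport u) :
    HasCompactSupport (hessianLoad p Λ u η) := by
  refine (hasCompactSupport_grad huc).mono fun x hx => ?_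
  contrapose! hx
  simp only [Function.mem_support, not_not] at hx ⊢
  simp [hessianLoad, hx, Real.zero_rpow (by linarith : p - 1 ≠ 0),
    Real.zero_rpow (by linarith : p ≠ 0)]

theorem continuous_firstOrderLoad (hp : 1 < p) (hu : ContDiff ℝ 1 u) (hη : ContDiff ℝ 2 η) :
    Continuous fun q : ℝ × Euc n => firstOrderLoad p Λ τ σ u η β q.1 q.2 := by
  have hG' := continuous_grad hu
  have hG := hG'.norm
  have h1 := continuous_rpow_norm_grad hu (by linarith : 0 ≤ p - 1)
  have h2 := continuous_rpow_norm_grad hu (by linarith : 0 ≤ p)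
  have h3 := continuous_hessianLoad (Λ := Λ) hp hu hη
  have h4 := hη.continuous
  have hs : Continuous fun q : ℝ × Euc n => q.2 + -q.1 • e[β] := by fun_prop
  have h5 : Continuous fun q : ℝ × Euc n =>
      segAvg e[β] (fun z => ‖grad u z‖) q.1 (q.2 + -q.1 • e[β]) :=
    continuous_segAvg hG continuous_fst hs
  have h6 : Continuous fun q : ℝ × Euc n =>
      segAvg e[β] (segAvg e[β] (fun z => ‖grad u z‖) q.1) (-q.1) q.2 := by
    unfold segAvg
    refine intervalIntegral.continuous_parametric_intervalIntegral_of_continuous'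
      (f := fun (q : ℝ × Euc n) s =>
        ∫ t in (0 : ℝ)..1, ‖grad u (q.2 + (s * -q.1) • e[β] + (t * q.1) • e[β])‖) ?_ 0 1
    exact intervalIntegral.continuous_parametric_intervalIntegral_of_continuous'
      (f := fun (q : (ℝ × Euc n) × ℝ) t =>
        ‖grad u (q.1.2 + (q.2 * -q.1.1) • e[β] + (t * q.1.1) • e[β])‖) (by fun_prop) 0 1
  exact (((continuous_const.mul (h1.comp continuous_snd)).add (continuous_const.mul
    (h2.comp continuous_snd))).mul ((h4.comp hs).mul h5)).add
    (continuous_const.mul ((h3.comp continuous_snd).mul h6))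

theorem continuous_youngLoad (hp₁ : 1 < p) (hp₂ : p < 2) (hu : ContDiff ℝ 1 u)
    (hη : ContDiff ℝ 2 η) :
    Continuous fun q : ℝ × Euc n => youngLoad p Λ u η β q.1 q.2 := by
  have hG' := continuous_grad hu
  have hG := hG'.norm
  have h1 : Continuous fun q : ℝ × Euc n => segAvg e[β] (hessianLoad p Λ u η) q.1 q.2 :=
    continuous_segAvg (continuous_hessianLoad hp₁ hu hη) continuous_fst continuous_snd
  have h2 : Continuous fun q : ℝ × Euc n => ‖grad u q.2‖ + ‖grad u (q.2 + q.1 • e[β])‖ + q.1 := by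
    fun_prop
  exact (h2.rpow_const fun _ => Or.inr (by linarith)).mul (h1.pow 2)

theorem firstOrderLoad_eq_zero (hp : 1 < p) {x : Euc n} (hx : grad u x = 0) :
    firstOrderLoad p Λ τ σ u η β h x = 0 := by
  simp [firstOrderLoad, hessianLoad, hx, Real.zero_rpow (by linarith : p - 1 ≠ 0),
    Real.zero_rpow (by linarith : p ≠ 0)]

/-- The bound on difference quotients has a limit as the increment tends to zero. -/
theorem tendsto_diffQuotBound (hp₁ : 1 < p) (hp₂ : p < 2) (hu : ContDiff ℝ 1 u)
    (huc : HasCompactSupport u) (hη : ContDiff ℝ 2 η) :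
    Filter.Tendsto (diffQuotBound p Λ τ σ M u η β) (𝓝 0)
      (𝓝 (diffQuotBound p Λ τ σ M u η β 0)) := by
  obtain ⟨R, hR⟩ := exists_norm_bound_of_hasCompactSupport
    (hasCompactSupport_hessianLoad (Λ := Λ) (η := η) hp₁ huc)
  obtain ⟨R', hR'⟩ := exists_norm_bound_of_hasCompactSupport (hasCompactSupport_grad huc)
  -- For |h| ≤ 1 an average along a unit vector enlarges the support by at most 1, hence the radius
  -- R + 1.
  have t1 := tendsto_integral_of_hasCompactSupport volume (F := youngLoad p Λ u η β)
    (R := R + 1) (continuous_youngLoad hp₁ hp₂ hu hη) (fun h x hh hx => by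
      rw [youngLoad, segAvg_eq_zero hR]
      · simp
      · simpa using hx.trans_le' (by linarith))
  have t2 := tendsto_integral_of_hasCompactSupport volume (F := firstOrderLoad p Λ τ σ u η β)
    (R := R') (continuous_firstOrderLoad hp₁ hu hη)
    (fun h x _ hx => firstOrderLoad_eq_zero hp₁ (hR' x hx))
  have t3 : Filter.Tendsto (fun h : ℝ => (2 * M + h) ^ (2 - p)) (𝓝 0)
      (𝓝 ((2 * M + 0) ^ (2 - p))) :=
    Continuous.tendsto ((continuous_const.add continuous_id).rpow_const
      fun _ => Or.inr (by linarith)) 0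
  exact t3.mul (((t1.const_mul _).add t2).const_mul _)

/-- After the pointwise bounds, all second differences sit in ∫ P · A_{-h}|η D_h ∇u|, with P =
`hessianLoad` and A the segment average. Adjointness replaces this by ∫ A_h P · |η D_h ∇u|. -/
theorem integral_inner_diffQuot_pField_le (hp : 1 < p) (hΛ : 0 ≤ Λ)
    (hu : ContDiff ℝ 1 u) (huc : HasCompactSupport u) (hη : ContDiff ℝ 2 η)
    (hηc : HasCompactSupport η) (hη0 : ∀ x, 0 ≤ η x) (hτ : ∀ x, ‖scalarGrad η x‖ ≤ τ)
    (hσ : ∀ x, ‖fderiv ℝ (scalarGrad η) x e[β]‖ ≤ σ) (hh : h ≠ 0)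
    (hweak : |∫ x, inner ℝ (pField p (grad u x))
        (grad (diffQuot e[β] (-h) fun z => η z • η z • diffQuot e[β] h u z) x)| ≤
      Λ * ∫ x, ‖grad u x‖ ^ p * ‖diffQuot e[β] (-h) (fun z => η z • η z • diffQuot e[β] h u z) x‖) :
    ∫ x, η x ^ 2 * inner ℝ (diffQuot e[β] h (fun z => pField p (grad u z)) x)
        (diffQuot e[β] h (grad u) x) ≤
      (∫ x, segAvg e[β] (hessianLoad p Λ u η) h x * ‖η x • diffQuot e[β] h (grad u) x‖) +
        ∫ x, firstOrderLoad p Λ τ σ u η β h x := by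
  have hg : Continuous fun z => ‖η z • diffQuot e[β] h (grad u) z‖ :=
    (hη.continuous.smul (continuous_diffQuot (continuous_grad hu) h)).norm
  have hDu : Continuous (diffQuot e[β] h u) := continuous_diffQuot hu.continuous h
  have hV : Continuous fun z => pField p (grad u z) :=
    (continuous_pField hp).comp (continuous_grad hu)
  have hφ : Continuous (diffQuot e[β] (-h) fun z => η z • η z • diffQuot e[β] h u z) :=
    continuous_diffQuot (hη.continuous.smul (hη.continuous.smul hDu)) _
  have hW : Continuous (diffQuot e[β] (-h)
      fun z => tensor (scalarGrad η z) (η z • diffQuot e[β] h u z)) :=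
    continuous_diffQuot (continuous_tensor (contDiff_scalarGrad hη).continuous
      (hη.continuous.smul hDu)) _
  have hGc := hasCompactSupport_grad huc
  have hp1 : (0 : ℝ) ^ (p - 1) = 0 := Real.zero_rpow (by linarith)
  have hp0 : (0 : ℝ) ^ p = 0 := Real.zero_rpow (by linarith)
  rw [integral_inner_diffQuot_pField hp hu hη hηc, ← integral_mul_segAvg_neg volume
    (continuous_hessianLoad hp hu hη) hg (hasCompactSupport_hessianLoad hp huc)]
  have i1 : Integrable fun x => ‖grad u x‖ ^ p *
      ‖diffQuot e[β] (-h) (fun z => η z • η z • diffQuot e[β] h u z) x‖ :=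
    integrable_of_support_subset ((continuous_rpow_norm_grad hu (by linarith)).mul hφ.norm) hGc
      fun x hx => by simp [hx, hp0]
  have i2 : Integrable fun x => ‖grad u x‖ ^ (p - 1) * ‖diffQuot e[β] (-h)
      (fun z => tensor (scalarGrad η z) (η z • diffQuot e[β] h u z)) x‖ :=
    integrable_of_support_subset ((continuous_rpow_norm_grad hu (by linarith)).mul hW.norm) hGc
      fun x hx => by simp [hx, hp1]
  have hA : Continuous (segAvg e[β] (fun z => ‖η z • diffQuot e[β] h (grad u) z‖) (-h)) :=
    continuous_segAvg hg continuous_const continuous_id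
  have hL : Continuous (firstOrderLoad p Λ τ σ u η β h) :=
    Continuous.uncurry_left h (f := firstOrderLoad p Λ τ σ u η β)
      (continuous_firstOrderLoad hp hu hη)
  have i3 : Integrable fun x => hessianLoad p Λ u η x *
      segAvg e[β] (fun z => ‖η z • diffQuot e[β] h (grad u) z‖) (-h) x :=
    integrable_of_support_subset ((continuous_hessianLoad hp hu hη).mul hA) hGc
      fun x hx => by simp [hessianLoad, hx, hp1, hp0]
  have i4 : Integrable (firstOrderLoad p Λ τ σ u η β h) :=
    integrable_of_support_subset hL hGc fun x hx => firstOrderLoad_eq_zero hp hx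
  have hVW : ∫ x, inner ℝ (pField p (grad u x)) (diffQuot e[β] (-h)
      (fun z => tensor (scalarGrad η z) (η z • diffQuot e[β] h u z)) x) ≤
      ∫ x, ‖grad u x‖ ^ (p - 1) * ‖diffQuot e[β] (-h)
        (fun z => tensor (scalarGrad η z) (η z • diffQuot e[β] h u z)) x‖ := by
    refine integral_mono (integrable_of_support_subset (hV.inner hW) hGc
      fun x hx => by simp [hx, pField]) i2 fun x => ?_
    rw [← norm_pField hp]
    exact real_inner_le_norm _ _
  calc _ ≤ Λ * (∫ x, ‖grad u x‖ ^ p *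
          ‖diffQuot e[β] (-h) (fun z => η z • η z • diffQuot e[β] h u z) x‖) +
        2 * ∫ x, ‖grad u x‖ ^ (p - 1) * ‖diffQuot e[β] (-h)
          (fun z => tensor (scalarGrad η z) (η z • diffQuot e[β] h u z)) x‖ := by
        linarith [neg_abs_le (∫ x, inner ℝ (pField p (grad u x))
          (grad (diffQuot e[β] (-h) fun z => η z • η z • diffQuot e[β] h u z) x))]
    _ ≤ _ := by
        rw [← integral_const_mul, ← integral_const_mul,
          ← integral_add (i1.const_mul _) (i2.const_mul _), ← integral_add i3 i4]
        refine integral_mono ((i1.const_mul _).add (i2.const_mul _)) (i3.add i4) fun x => ?_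
        have b1 := mul_le_mul_of_nonneg_left (norm_testFunction_le (β := β) hu hη hη0 hτ hh x)
          (mul_nonneg hΛ (Real.rpow_nonneg (norm_nonneg (grad u x)) p))
        have b2 := mul_le_mul_of_nonneg_left
          (norm_diffQuot_neg_tensor_le (β := β) hu hη hη0 hτ hσ hh x)
          (mul_nonneg zero_le_two (Real.rpow_nonneg (norm_nonneg (grad u x)) (p - 1)))
        simp only [hessianLoad, firstOrderLoad]
        linear_combination b1 + b2

/-- The difference quotient estimate for the gradient. -/
theorem integral_norm_sq_diffQuot_grad_le (hp₁ : 1 < p) (hp₂ : p < 2) (hΛ : 0 ≤ Λ)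
    (hu : ContDiff ℝ 1 u) (huc : HasCompactSupport u) (hη : ContDiff ℝ 2 η)
    (hηc : HasCompactSupport η) (hη0 : ∀ x, 0 ≤ η x) (hτ : ∀ x, ‖scalarGrad η x‖ ≤ τ)
    (hσ : ∀ x, ‖fderiv ℝ (scalarGrad η) x e[β]‖ ≤ σ) (hh : 0 < h) (hM0 : 0 ≤ M)
    (hM : ∀ x, η x ≠ 0 → ‖grad u x‖ ≤ M ∧ ‖grad u (x + h • e[β])‖ ≤ M)
    (hweak : |∫ x, inner ℝ (pField p (grad u x))
        (grad (diffQuot e[β] (-h) fun z => η z • η z • diffQuot e[β] h u z) x)| ≤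
      Λ * ∫ x, ‖grad u x‖ ^ p * ‖diffQuot e[β] (-h) (fun z => η z • η z • diffQuot e[β] h u z) x‖) :
    ∫ x, ‖η x • diffQuot e[β] h (grad u) x‖ ^ 2 ≤ diffQuotBound p Λ τ σ M u η β h := by
  have hI := integral_inner_diffQuot_pField_le hp₁ hΛ hu huc hη hηc hη0 hτ hσ hh.ne' hweak
  have hc : 0 < p - 1 := by linarith
  have hD := continuous_diffQuot (e := e[β]) (continuous_grad hu) h
  have hg : Continuous fun z => ‖η z • diffQuot e[β] h (grad u) z‖ := (hη.continuous.smul hD).norm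
  have hV : Continuous fun z => pField p (grad u z) :=
    (continuous_pField hp₁).comp (continuous_grad hu)
  have hb0 : ∀ x, 0 < ‖grad u x‖ + ‖grad u (x + h • e[β])‖ + h := fun x => by positivity
  have hbc : Continuous fun x => ‖grad u x‖ + ‖grad u (x + h • e[β])‖ + h := by
    have := continuous_grad hu
    fun_prop
  -- The weight of `pField_monotone` with δ = h, which keeps the base positive, and w continuous,
  -- even where both gradients vanish.
  set w : Euc n → ℝ := fun x => (‖grad u x‖ + ‖grad u (x + h • e[β])‖ + h) ^ (p - 2) with hw
  have hwc : Continuous w := hbc.rpow_const fun x => Or.inl (hb0 x).ne'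
  have hw0 : ∀ x, 0 < w x := fun x => Real.rpow_pos_of_pos (hb0 x) _
  have hwinv : ∀ x, (‖grad u x‖ + ‖grad u (x + h • e[β])‖ + h) ^ (2 - p) = (w x)⁻¹ := fun x => by
    rw [hw, ← Real.rpow_neg (hb0 x).le, neg_sub]
  have hP : Continuous (segAvg e[β] (hessianLoad p Λ u η) h) :=
    continuous_segAvg (continuous_hessianLoad hp₁ hu hη) continuous_const continuous_id
  have hPc : HasCompactSupport (segAvg e[β] (hessianLoad p Λ u η) h) :=
    hasCompactSupport_segAvg (hasCompactSupport_hessianLoad hp₁ huc) h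
  have hY : Continuous (youngLoad p Λ u η β h) :=
    Continuous.uncurry_left h (f := youngLoad p Λ u η β) (continuous_youngLoad hp₁ hp₂ hu hη)
  have j1 : Integrable fun x => w x * ‖η x • diffQuot e[β] h (grad u) x‖ ^ 2 :=
    integrable_of_support_subset (hwc.mul (hg.pow 2)) hηc fun x hx => by simp [hx]
  have j2 : Integrable fun x => η x ^ 2 * inner ℝ
      (diffQuot e[β] h (fun z => pField p (grad u z)) x) (diffQuot e[β] h (grad u) x) :=
    integrable_of_support_subset ((hη.continuous.pow 2).mul
      ((continuous_diffQuot hV h).inner hD)) hηc fun x hx => by simp [hx]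
  have j3 : Integrable fun x =>
      segAvg e[β] (hessianLoad p Λ u η) h x * ‖η x • diffQuot e[β] h (grad u) x‖ :=
    integrable_of_support_subset (hP.mul hg) hηc fun x hx => by simp [hx]
  have j4 : Integrable (youngLoad p Λ u η β h) :=
    integrable_of_support_subset hY hPc fun x hx => by simp [youngLoad, hx]
  have j5 : Integrable fun x => ‖η x • diffQuot e[β] h (grad u) x‖ ^ 2 :=
    integrable_of_support_subset (hg.pow 2) hηc fun x hx => by simp [hx]
  have low : (p - 1) * ∫ x, w x * ‖η x • diffQuot e[β] h (grad u) x‖ ^ 2 ≤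
      ∫ x, η x ^ 2 * inner ℝ (diffQuot e[β] h (fun z => pField p (grad u z)) x)
        (diffQuot e[β] h (grad u) x) := by
    rw [← integral_const_mul]
    refine integral_mono (j1.const_mul _) j2 fun x => ?_
    have := pField_monotone hp₁ hp₂ hh (grad u (x + h • e[β])) (grad u x)
    rw [add_comm ‖grad u (x + h • e[β])‖] at this
    have h2 := mul_le_mul_of_nonneg_left this (mul_nonneg (sq_nonneg (η x)) (sq_nonneg h⁻¹))
    simp only [diffQuot, norm_smul, real_inner_smul_left, real_inner_smul_right, mul_pow,
      Real.norm_eq_abs, sq_abs, hw]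
    linear_combination h2
  -- Young's inequality with weight (p-1) w: exactly half of the lower bound `low` is spent, and the
  -- other half survives.
  have young : ∫ x, segAvg e[β] (hessianLoad p Λ u η) h x * ‖η x • diffQuot e[β] h (grad u) x‖ ≤
      (p - 1) / 2 * (∫ x, w x * ‖η x • diffQuot e[β] h (grad u) x‖ ^ 2) +
        (2 * (p - 1))⁻¹ * ∫ x, youngLoad p Λ u η β h x := by
    rw [← integral_const_mul, ← integral_const_mul,
      ← integral_add (j1.const_mul _) (j4.const_mul _)]
    refine integral_mono j3 ((j1.const_mul _).add (j4.const_mul _)) fun x => ?_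
    simp only [youngLoad, hwinv]
    have := hw0 x
    generalize segAvg e[β] (hessianLoad p Λ u η) h x = a
    generalize ‖η x • diffQuot e[β] h (grad u) x‖ = b
    generalize w x = ρ at *
    have hsq : (p - 1) / 2 * (ρ * b ^ 2) + (2 * (p - 1))⁻¹ * (ρ⁻¹ * a ^ 2) - a * b
        = (2 * (p - 1) * ρ)⁻¹ * ((p - 1) * ρ * b - a) ^ 2 := by
      field_simp
      ring
    have : 0 ≤ (2 * (p - 1) * ρ)⁻¹ * ((p - 1) * ρ * b - a) ^ 2 := by positivity
    linarith
  have up : ∫ x, ‖η x • diffQuot e[β] h (grad u) x‖ ^ 2 ≤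
      (2 * M + h) ^ (2 - p) * ∫ x, w x * ‖η x • diffQuot e[β] h (grad u) x‖ ^ 2 := by
    rw [← integral_const_mul]
    refine integral_mono j5 (j1.const_mul _) fun x => ?_
    dsimp only
    rcases eq_or_ne (η x) 0 with h0 | h0
    · simp [h0]
    rw [← mul_assoc]
    refine le_mul_of_one_le_left (sq_nonneg _) ?_
    -- Here p < 2 is essential: the exponent 2 - p is positive, so small gradients only help.
    have h1 : (w x)⁻¹ ≤ (2 * M + h) ^ (2 - p) := by
      rw [← hwinv]
      exact Real.rpow_le_rpow (hb0 x).le (by linarith [(hM x h0).1, (hM x h0).2]) (by linarith)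
    calc 1 = (w x)⁻¹ * w x := (inv_mul_cancel₀ (hw0 x).ne').symm
      _ ≤ _ := mul_le_mul_of_nonneg_right h1 (hw0 x).le
  refine up.trans (mul_le_mul_of_nonneg_left ?_ (by positivity))
  rw [div_mul_eq_mul_div, le_div_iff₀ hc]
  linarith

end Absorption

/-! ### Localization -/

section Localization

variable {n k : ℕ} {p Λ M τ σ : ℝ}

/-- Smooth cutoff functions between a compact and an open set. -/
theorem exists_smooth_cutoff {K O : Set (Euc n)} (hK : IsCompact K) (hO : IsOpen O)
    (hKO : K ⊆ O) :
    ∃ (χ : Euc n → ℝ) (O' : Set (Euc n)), ContDiff ℝ ∞ χ ∧ HasCompactSupport χ ∧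
      tsupport χ ⊆ O ∧ (∀ x, 0 ≤ χ x ∧ χ x ≤ 1) ∧ IsOpen O' ∧ K ⊆ O' ∧ O' ⊆ O ∧
      ∀ x ∈ O', χ x = 1 := by
  obtain ⟨O₁, hO₁, hKO₁, hO₁O, hO₁c⟩ := exists_open_between_and_isCompact_closure hK hO hKO
  obtain ⟨χ, h1, h0, hI⟩ := exists_contMDiffMap_one_nhds_of_subset_interior (n := ⊤)
    (modelWithCornersSelf ℝ (Euc n)) hK.isClosed
    (hKO₁.trans (interior_maximal subset_closure hO₁))
  obtain ⟨O₂, hO₂, hKO₂, hχ⟩ := eventually_nhdsSet_iff_exists.1 h1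
  have hsupp : tsupport χ ⊆ closure O₁ := closure_minimal
    (fun x hx => by_contra fun hx' => hx (h0 x hx')) isClosed_closure
  exact ⟨χ, O₂ ∩ O₁, χ.contMDiff.contDiff, hO₁c.of_isClosed_subset (isClosed_tsupport _) hsupp,
    hsupp.trans hO₁O, fun x => hI x, hO₂.inter hO₁, subset_inter hKO₂ hKO₁,
    fun x hx => hO₁O (subset_closure hx.2), fun x hx => hχ x hx.1⟩

theorem partialDeriv_congr {F : Type*} [NormedAddCommGroup F] [NormedSpace ℝ F]
    {f g : Euc n → F} {O : Set (Euc n)} (hO : IsOpen O) (hfg : ∀ x ∈ O, f x = g x)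
    (α : Fin n) {x : Euc n} (hx : x ∈ O) : partialDeriv α f x = partialDeriv α g x := by
  have : f =ᶠ[𝓝 x] g := Filter.eventually_of_mem (hO.mem_nhds hx) hfg
  rw [partialDeriv, partialDeriv, this.fderiv_eq]

theorem grad_congr {f g : Euc n → Euc k} {O : Set (Euc n)} (hO : IsOpen O)
    (hfg : ∀ x ∈ O, f x = g x) {x : Euc n} (hx : x ∈ O) : grad f x = grad g x := by
  ext α : 1
  exact partialDeriv_congr hO hfg α hx

theorem partialDeriv_eq_zero {F : Type*} [NormedAddCommGroup F] [NormedSpace ℝ F]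
    {f : Euc n → F} (α : Fin n) {x : Euc n} (hx : x ∉ tsupport f) : partialDeriv α f x = 0 := by
  rw [partialDeriv, fderiv_of_notMem_tsupport ℝ hx, zero_apply]

theorem grad_eq_zero {f : Euc n → Euc k} {x : Euc n} (hx : x ∉ tsupport f) : grad f x = 0 := by
  ext α : 1
  exact partialDeriv_eq_zero α hx

theorem scalarGrad_eq_zero {f : Euc n → ℝ} {x : Euc n} (hx : x ∉ tsupport f) :
    scalarGrad f x = 0 := by
  ext α : 1
  exact partialDeriv_eq_zero α hx

theorem continuousOn_partialDeriv {Ω : Set (Euc n)} (hΩ : IsOpen Ω) {u : Euc n → Euc k}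
    (hu : ContDiffOn ℝ 1 u Ω) (α : Fin n) : ContinuousOn (partialDeriv α u) Ω :=
  (hu.continuousOn_fderiv_of_isOpen hΩ (by norm_num)).clm_apply continuousOn_const

theorem continuousOn_grad {Ω : Set (Euc n)} (hΩ : IsOpen Ω) {u : Euc n → Euc k}
    (hu : ContDiffOn ℝ 1 u Ω) : ContinuousOn (grad u) Ω := by
  have := fun α => continuousOn_partialDeriv hΩ hu α
  unfold grad
  fun_prop

theorem integrable_of_continuousOn_tsupport {F F' : Type*} [NormedAddCommGroup F] [Zero F']
    {f : Euc n → F} {g : Euc n → F'} (hf : ContinuousOn f (tsupport g))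
    (hg : HasCompactSupport g) (hfg : ∀ x, x ∉ tsupport g → f x = 0) : Integrable f := by
  rw [← integrableOn_univ]
  exact IntegrableOn.of_forall_sdiff_eq_zero (hf.integrableOn_compact hg) MeasurableSet.univ
    fun x hx => hfg x hx.2

/-- A classical partial derivative is a weak one. -/
theorem hasWeakPartialDeriv_of_contDiffOn {U : Set (Euc n)} (hU : IsOpen U) {u : Euc n → Euc k}
    (hu : ContDiffOn ℝ 1 u U) (α : Fin n) : HasWeakPartialDeriv U α u (partialDeriv α u) := by
  refine ⟨hu.continuousOn.locallyIntegrableOn hU.measurableSet,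
    (continuousOn_partialDeriv hU hu α).locallyIntegrableOn hU.measurableSet, ?_⟩
  rintro φ ⟨hφ, hφc, hφU⟩
  have hφ1 : ContDiff ℝ 1 φ := hφ.of_le (by simp)
  have hφ' := continuous_partialDeriv hφ1 α
  have z1 : ∀ x, x ∉ tsupport φ → partialDeriv α φ x • u x = 0 := fun x hx => by
    rw [partialDeriv_eq_zero α hx, zero_smul]
  have z2 : ∀ x, x ∉ tsupport φ → φ x • partialDeriv α u x = 0 := fun x hx => by
    rw [image_eq_zero_of_notMem_tsupport hx, zero_smul]
  have z3 : ∀ x, x ∉ tsupport φ → φ x • u x = 0 := fun x hx => by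
    rw [image_eq_zero_of_notMem_tsupport hx, zero_smul]
  rw [setIntegral_eq_integral_of_forall_compl_eq_zero fun x hx => z1 x fun h => hx (hφU h),
    setIntegral_eq_integral_of_forall_compl_eq_zero fun x hx => z2 x fun h => hx (hφU h)]
  have := integral_smul_fderiv_eq_neg_fderiv_smul_of_integrable (μ := volume) (f := φ) (g := u)
    (v := EuclideanSpace.single α (1 : ℝ))
    (integrable_of_continuousOn_tsupport
      (hφ'.continuousOn.smul (hu.continuousOn.mono hφU)) hφc z1)
    (integrable_of_continuousOn_tsupport (hφ.continuous.continuousOn.smul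
      ((continuousOn_partialDeriv hU hu α).mono hφU)) hφc z2)
    (integrable_of_continuousOn_tsupport
      (hφ.continuous.continuousOn.smul (hu.continuousOn.mono hφU)) hφc z3)
    (fun x _ => hφ1.differentiable (by norm_num) x)
    (fun x hx => (hu.contDiffAt (hU.mem_nhds (hφU hx))).differentiableAt (by norm_num))
  simp only [partialDeriv]
  rw [this, neg_neg]

/-- At h = 0 the load P is at most |∇u|^(p-1) (2τ + ΛM), and the inverse weight is (2|∇u|)^(2-p) ≤
2|∇u|^(2-p). The exponents add up to (2-p) + 2(p-1) = p. -/
theorem youngLoad_zero_le (hp₁ : 1 < p) (hp₂ : p < 2) (hΛ : 0 ≤ Λ) {u : Euc n → Euc k}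
    {η : Euc n → ℝ} (hη : ∀ x, 0 ≤ η x ∧ η x ≤ 1) (hτ : ∀ x, ‖scalarGrad η x‖ ≤ τ) {β : Fin n}
    {x : Euc n} (hM : ‖grad u x‖ ≤ M) :
    youngLoad p Λ u η β 0 x ≤ 2 * (2 * τ + Λ * M) ^ 2 * ‖grad u x‖ ^ p := by
  simp only [youngLoad, segAvg_zero, hessianLoad, zero_smul, add_zero]
  obtain h0 | hG := (norm_nonneg (grad u x)).eq_or_lt
  · rw [← h0, add_zero, Real.zero_rpow (by linarith), zero_mul, Real.zero_rpow (by linarith),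
      mul_zero]
  have hT0 := norm_nonneg (scalarGrad η x)
  have hT := hτ x
  generalize ‖scalarGrad η x‖ = T at *
  generalize ‖grad u x‖ = G at *
  have e1 : G ^ p = G ^ (p - 1) * G := by rw [← Real.rpow_add_one hG.ne']; ring_nf
  have e2 : (G + G) ^ (2 - p) ≤ 2 * G ^ (2 - p) := by
    rw [← two_mul, Real.mul_rpow zero_le_two hG.le]
    gcongr
    calc (2 : ℝ) ^ (2 - p) ≤ 2 ^ (1 : ℝ) := Real.rpow_le_rpow_of_exponent_le (by norm_num)
          (by linarith)
      _ = 2 := by simp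
  have e3 : G ^ (2 - p) * (G ^ (p - 1)) ^ 2 = G ^ p := by
    rw [← Real.rpow_natCast, ← Real.rpow_mul hG.le, ← Real.rpow_add hG]
    congr 1
    push_cast
    ring
  have hq : 0 < G ^ (p - 1) := by positivity
  have e4 : 2 * G ^ (p - 1) * T + Λ * G ^ p * η x ≤ G ^ (p - 1) * (2 * τ + Λ * M) := by
    have h1 : G ^ (p - 1) * T ≤ G ^ (p - 1) * τ := by gcongr
    have h2 : Λ * (G ^ (p - 1) * (G * η x)) ≤ Λ * (G ^ (p - 1) * M) := by
      gcongr
      exact (mul_le_of_le_one_right hG.le (hη x).2).trans hM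
    rw [e1]
    linear_combination 2 * h1 + h2
  calc _ ≤ 2 * G ^ (2 - p) * (G ^ (p - 1) * (2 * τ + Λ * M)) ^ 2 := by
        have := (hη x).1
        gcongr
    _ = 2 * (2 * τ + Λ * M) ^ 2 * (G ^ (2 - p) * (G ^ (p - 1)) ^ 2) := by ring
    _ = _ := by rw [e3]

theorem firstOrderLoad_zero_le (hp₁ : 1 < p) (hΛ : 0 ≤ Λ) {u : Euc n → Euc k}
    {η : Euc n → ℝ} (hη : ∀ x, 0 ≤ η x ∧ η x ≤ 1) (hτ : ∀ x, ‖scalarGrad η x‖ ≤ τ) (hσ : 0 ≤ σ)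
    {β : Fin n} {x : Euc n} (hM : ‖grad u x‖ ≤ M) :
    firstOrderLoad p Λ τ σ u η β 0 x ≤
      (2 * σ + 2 * (Λ * τ * M) + 2 * τ ^ 2) * ‖grad u x‖ ^ p := by
  simp only [firstOrderLoad, segAvg_zero, hessianLoad, neg_zero, zero_smul, add_zero]
  obtain h0 | hG := (norm_nonneg (grad u x)).eq_or_lt
  · rw [← h0, Real.zero_rpow (by linarith), Real.zero_rpow (by linarith)]
    simp
  have hT0 := norm_nonneg (scalarGrad η x)
  have hT := hτ x
  obtain ⟨hη0, hη1⟩ := hη x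
  generalize ‖scalarGrad η x‖ = T at *
  generalize ‖grad u x‖ = G at *
  have hτ0 : 0 ≤ τ := hT0.trans hT
  have e1 : G ^ (p - 1) * G = G ^ p := by rw [← Real.rpow_add_one hG.ne']; ring_nf
  have hq : 0 < G ^ p := by positivity
  have h1 : σ * G ^ p * η x ≤ σ * G ^ p * 1 := by gcongr
  have h2 : τ * G ^ p * T ≤ τ * G ^ p * τ := by gcongr
  have h3 : Λ * τ * G ^ p * (G * η x) ≤ Λ * τ * G ^ p * M := by
    gcongr
    exact (mul_le_of_le_one_right hG.le hη1).trans hM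
  linear_combination 2 * h1 + 2 * h2 + 2 * h3 + (2 * σ * η x + 2 * τ * T) * e1

/-- Interior second order regularity, with a cutoff function, for maps satisfying the inequality
form of the `p`-harmonic map equation. -/
theorem exists_weak_second_deriv (hp₁ : 1 < p) (hp₂ : p < 2) (hΛ : 0 ≤ Λ) {Ω : Set (Euc n)}
    (hΩ : IsOpen Ω) {u : Euc n → Euc k} (hu : ContDiffOn ℝ 1 u Ω)
    (hweak : ∀ φ : Euc n → Euc k, IsTestFunction 1 Ω φ →
      |∫ x in Ω, inner ℝ (pField p (grad u x)) (grad φ x)| ≤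
        Λ * ∫ x in Ω, ‖grad u x‖ ^ p * ‖φ x‖)
    {η : Euc n → ℝ} (hη : ContDiff ℝ 2 η) (hηc : HasCompactSupport η) (hηΩ : tsupport η ⊆ Ω)
    (hη01 : ∀ x, 0 ≤ η x ∧ η x ≤ 1) (hτ : ∀ x, ‖scalarGrad η x‖ ≤ τ) {β : Fin n}
    (hσ : ∀ x, ‖fderiv ℝ (scalarGrad η) x (EuclideanSpace.single β 1)‖ ≤ σ)
    (hM0 : 0 ≤ M) (hM : ∀ x ∈ Ω, ‖grad u x‖ ≤ M)
    (hint : IntegrableOn (fun x => ‖grad u x‖ ^ p) Ω)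
    {U : Set (Euc n)} (hU : IsOpen U) (hηU : ∀ x ∈ U, η x = 1) (α : Fin n) :
    ∃ H : Euc n → Euc k, HasWeakPartialDeriv U β (partialDeriv α u) H ∧
      MemLp H 2 (volume.restrict U) ∧
      ∫ x in U, ‖H x‖ ^ 2 ≤ (2 * M) ^ (2 - p) * (2 / (p - 1) * ((p - 1)⁻¹ * (2 * τ + Λ * M) ^ 2 +
        (2 * σ + 2 * (Λ * τ * M) + 2 * τ ^ 2))) * ∫ x in Ω, ‖grad u x‖ ^ p := by
  -- The map u is replaced by v = χ u, which is C¹ with compact support on the whole space and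
  -- equals u on a neighbourhood O of the support of η. For small h every integrand involved sees
  -- only O.
  obtain ⟨χ, O, hχ, hχc, hχΩ, -, hO, hηO, hOΩ, hχO⟩ := exists_smooth_cutoff hηc hΩ hηΩ
  set K := tsupport η with hKdef
  set v : Euc n → Euc k := fun x => χ x • u x with hv
  have hvO : ∀ x ∈ O, v x = u x := fun x hx => by simp [hv, hχO x hx]
  have hvg : ∀ x ∈ O, grad v x = grad u x := fun x hx => grad_congr hO hvO hx
  have hvc : HasCompactSupport v := hχc.smul_right
  have hv1 : ContDiff ℝ 1 v := by
    refine contDiff_iff_contDiffAt.2 fun x => ?_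
    by_cases hx : x ∈ tsupport v
    swap
    · exact contDiffAt_const.congr_of_eventuallyEq (notMem_tsupport_iff_eventuallyEq.1 hx)
    have hxΩ : x ∈ Ω := hχΩ (tsupport_smul_subset_left χ u hx)
    exact (hχ.of_le (by simp)).contDiffAt.smul (hu.contDiffAt (hΩ.mem_nhds hxΩ))
  have hUK : U ⊆ K := fun x hx => subset_tsupport η (by simp [hηU x hx])
  -- Shifts by |h| ≤ ε keep the support of η inside O, so D_{-h}(η² D_h v) is admissible for the
  -- equation of u.
  obtain ⟨ε, hε, hεO⟩ := hηc.exists_cthickening_subset_open hO hηO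
  have hshift : ∀ h : ℝ, |h| ≤ ε → ∀ x ∈ K, x + h • EuclideanSpace.single β (1 : ℝ) ∈
      Metric.cthickening ε K := fun h hh x hx => by
    refine Metric.mem_cthickening_of_dist_le _ x ε K hx ?_
    simpa [dist_eq_norm, norm_smul] using hh
  have hest : ∀ᶠ h in 𝓝[>] (0 : ℝ),
      ∫ x, ‖η x • diffQuot (EuclideanSpace.single β 1) h (partialDeriv α v) x‖ ^ 2 ≤
        diffQuotBound p Λ τ σ M v η β h := by
    filter_upwards [Ioc_mem_nhdsGT hε] with h hh
    have hh' : |h| ≤ ε := by rw [abs_of_pos hh.1]; exact hh.2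
    set ψ : Euc n → Euc k := fun z => η z • η z • diffQuot (EuclideanSpace.single β 1) h v z
    have hψ : ContDiff ℝ 1 ψ :=
      (hη.of_le (by norm_num)).smul ((hη.of_le (by norm_num)).smul (contDiff_diffQuot hv1 h))
    have hψ0 : ∀ x, x ∉ K → ψ x = 0 := fun x hx => by
      simp [ψ, image_eq_zero_of_notMem_tsupport hx]
    have hφsupp : tsupport (diffQuot (EuclideanSpace.single β 1) (-h) ψ) ⊆ O := by
      refine (closure_minimal (fun x hx => ?_) Metric.isClosed_cthickening).trans hεO
      by_contra hx'
      apply hx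
      rw [diffQuot, hψ0 x fun hxK => hx' (Metric.self_subset_cthickening K hxK), hψ0, sub_zero,
        smul_zero]
      intro hxK
      apply hx'
      simpa using hshift h hh' _ hxK
    have htest : IsTestFunction 1 Ω (diffQuot (EuclideanSpace.single β 1) (-h) ψ) :=
      ⟨contDiff_diffQuot hψ _, hasCompactSupport_diffQuot hηc.smul_right _,
        hφsupp.trans hOΩ⟩
    have hw := hweak _ htest
    have c1 : ∫ x in Ω, inner ℝ (pField p (grad u x))
          (grad (diffQuot (EuclideanSpace.single β 1) (-h) ψ) x) =
        ∫ x, inner ℝ (pField p (grad v x))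
          (grad (diffQuot (EuclideanSpace.single β 1) (-h) ψ) x) := by
      rw [setIntegral_eq_integral_of_forall_compl_eq_zero fun x hx => by
        rw [grad_eq_zero fun h => hx (hOΩ (hφsupp h)), inner_zero_right]]
      congr 1
      ext x
      by_cases hx : x ∈ tsupport (diffQuot (EuclideanSpace.single β 1) (-h) ψ)
      · rw [hvg x (hφsupp hx)]
      · rw [grad_eq_zero hx, inner_zero_right, inner_zero_right]
    have c2 : ∫ x in Ω, ‖grad u x‖ ^ p * ‖diffQuot (EuclideanSpace.single β 1) (-h) ψ x‖ =
        ∫ x, ‖grad v x‖ ^ p * ‖diffQuot (EuclideanSpace.single β 1) (-h) ψ x‖ := by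
      rw [setIntegral_eq_integral_of_forall_compl_eq_zero fun x hx => by
        rw [image_eq_zero_of_notMem_tsupport fun h => hx (hOΩ (hφsupp h)), norm_zero, mul_zero]]
      congr 1
      ext x
      by_cases hx : x ∈ tsupport (diffQuot (EuclideanSpace.single β 1) (-h) ψ)
      · rw [hvg x (hφsupp hx)]
      · rw [image_eq_zero_of_notMem_tsupport hx, norm_zero, mul_zero, mul_zero]
    rw [c1, c2] at hw
    -- The estimate for the full gradient dominates that of its α-th component.
    refine le_trans ?_ (integral_norm_sq_diffQuot_grad_le (M := M) hp₁ hp₂ hΛ hv1 hvc hη hηc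
      (fun x => (hη01 x).1) hτ hσ hh.1 hM0 (fun x hx => ?_) hw)
    · refine integral_mono ?_ ?_ fun x => ?_
      · exact integrable_of_support_subset ((hη.continuous.smul
          (continuous_diffQuot (continuous_partialDeriv hv1 α) h)).norm.pow 2) hηc
          fun x hx => by simp [hx]
      · exact integrable_of_support_subset ((hη.continuous.smul
          (continuous_diffQuot (continuous_grad hv1) h)).norm.pow 2) hηc
          fun x hx => by simp [hx]
      · exact pow_le_pow_left₀ (norm_nonneg _) (PiLp.norm_apply_le
          (η x • diffQuot (EuclideanSpace.single β 1) h (grad v) x) α) 2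
    · have hxK : x ∈ K := subset_tsupport η hx
      have hxO := hηO hxK
      have hxO' := hεO (hshift h hh' x hxK)
      rw [hvg _ hxO, hvg _ hxO']
      exact ⟨hM _ (hOΩ hxO), hM _ (hOΩ hxO')⟩
  obtain ⟨H, hH, hHB, hHφ⟩ := exists_weak_deriv_of_diffQuot_bound volume
    (continuous_partialDeriv hv1 α) (hasCompactSupport_partialDeriv hvc α) hη.continuous
    ((tendsto_diffQuotBound hp₁ hp₂ hv1 hvc hη).mono_left nhdsWithin_le_nhds) hest
  have hUΩ : U ⊆ Ω := hUK.trans hηΩ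
  refine ⟨H, ⟨((continuousOn_partialDeriv hΩ hu α).mono hUΩ).locallyIntegrableOn
    hU.measurableSet, (hH.locallyIntegrable (by norm_num)).locallyIntegrableOn U, ?_⟩,
    hH.restrict U, ?_⟩
  · rintro φ ⟨hφ, hφc, hφU⟩
    have hφ1 : ContDiff ℝ 1 φ := hφ.of_le (by simp)
    have := hHφ φ hφ1 hφc fun x hx => hηU x (hφU (subset_tsupport φ hx))
    rw [setIntegral_eq_integral_of_forall_compl_eq_zero fun x hx => by
        rw [partialDeriv_eq_zero β fun h => hx (hφU h), zero_smul],
      setIntegral_eq_integral_of_forall_compl_eq_zero fun x hx => by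
        rw [image_eq_zero_of_notMem_tsupport fun h => hx (hφU h), zero_smul], ← this]
    congr 1
    ext1 x
    by_cases hx : x ∈ tsupport φ
    · rw [partialDeriv_congr hO hvO α (hηO (hUK (hφU hx)))]
      rfl
    · rw [partialDeriv_eq_zero β hx, zero_smul]
      simp [fderiv_of_notMem_tsupport ℝ hx]
  have hH2 : Integrable fun x => ‖H x‖ ^ 2 := by
    simpa using hH.integrable_norm_pow (p := 2) (by norm_num)
  refine (setIntegral_le_integral hH2 (Filter.Eventually.of_forall fun x => by positivity)).trans
    (hHB.trans ?_)
  have hpc : 0 < p - 1 := by linarith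
  have hσ0 : 0 ≤ σ := (norm_nonneg _).trans (hσ 0)
  have hload : ∀ x, x ∉ K → hessianLoad p Λ v η x = 0 := fun x hx => by
    simp [hessianLoad, image_eq_zero_of_notMem_tsupport hx, scalarGrad_eq_zero hx]
  have y0 : ∀ x, x ∉ K → youngLoad p Λ v η β 0 x = 0 := fun x hx => by
    simp [youngLoad, segAvg_zero, hload x hx]
  have f0 : ∀ x, x ∉ K → firstOrderLoad p Λ τ σ v η β 0 x = 0 := fun x hx => by
    simp [firstOrderLoad, hload x hx, image_eq_zero_of_notMem_tsupport hx]
  -- The weak limit inherits the bound at h = 0, where the loads vanish off K; on K the maps v and u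
  -- have the same gradient, so χ leaves no trace in the constant.
  have bound : ∀ (f : Euc n → ℝ) (c : ℝ), Continuous f → 0 ≤ c → (∀ x, x ∉ K → f x = 0) →
      (∀ x ∈ K, f x ≤ c * ‖grad v x‖ ^ p) → ∫ x, f x ≤ c * ∫ x in Ω, ‖grad u x‖ ^ p := by
    intro f c hf hc hfK hfb
    rw [← setIntegral_eq_integral_of_forall_compl_eq_zero (s := Ω)
      (fun x hx => hfK x fun h => hx (hηΩ h)), ← integral_const_mul]
    refine setIntegral_mono_on (integrable_of_continuousOn_tsupport hf.continuousOn hηc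
      hfK).integrableOn (hint.const_mul c) hΩ.measurableSet fun x hx => ?_
    by_cases hxK : x ∈ K
    · simpa only [hvg x (hηO hxK)] using hfb x hxK
    · rw [hfK x hxK]
      positivity
  have hvM : ∀ x ∈ K, ‖grad v x‖ ≤ M := fun x hx => by
    rw [hvg x (hηO hx)]
    exact hM x (hηΩ hx)
  have hτ0 : 0 ≤ τ := (norm_nonneg _).trans (hτ 0)
  have b1 := bound (youngLoad p Λ v η β 0) (2 * (2 * τ + Λ * M) ^ 2)
    (Continuous.uncurry_left 0 (f := youngLoad p Λ v η β) (continuous_youngLoad hp₁ hp₂ hv1 hη))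
    (by positivity) y0 fun x hx => youngLoad_zero_le hp₁ hp₂ hΛ hη01 hτ (hvM x hx)
  have b2 := bound (firstOrderLoad p Λ τ σ v η β 0) (2 * σ + 2 * (Λ * τ * M) + 2 * τ ^ 2)
    (Continuous.uncurry_left 0 (f := firstOrderLoad p Λ τ σ v η β)
      (continuous_firstOrderLoad hp₁ hv1 hη))
    (by positivity) f0 fun x hx => firstOrderLoad_zero_le hp₁ hΛ hη01 hτ hσ0 (hvM x hx)
  rw [diffQuotBound, add_zero, mul_assoc ((2 * M) ^ (2 - p)), mul_assoc (2 / (p - 1)), add_mul]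
  gcongr _ * (_ * ?_)
  refine add_le_add ?_ b2
  calc (2 * (p - 1))⁻¹ * ∫ x, youngLoad p Λ v η β 0 x
      ≤ (2 * (p - 1))⁻¹ * (2 * (2 * τ + Λ * M) ^ 2 * ∫ x in Ω, ‖grad u x‖ ^ p) := by gcongr
    _ = _ := by field_simp

end Localization

/-! ### `p`-harmonic maps -/

section PHarmonicMaps

variable {n k : ℕ} {p Λ : ℝ}

/-- Coordinate lines are mapped to curves in N. This makes the curvature bound, stated for tangent
vectors only, applicable to ∇u. -/
theorem partialDeriv_mem_tangentSpaceAt {Ω : Set (Euc n)} (hΩ : IsOpen Ω) {N : Set (Euc k)}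
    {u : Euc n → Euc k} (huN : ∀ x ∈ Ω, u x ∈ N) (hu : ContDiffOn ℝ 1 u Ω) {x : Euc n}
    (hx : x ∈ Ω) (α : Fin n) : partialDeriv α u x ∈ tangentSpaceAt N (u x) := by
  refine Submodule.subset_span
    ⟨fun t : ℝ => u (x + t • EuclideanSpace.single α (1 : ℝ)), by simp, ?_, ?_⟩
  · have hc : Continuous fun t : ℝ => x + t • EuclideanSpace.single α (1 : ℝ) := by fun_prop
    have := hc.tendsto 0
    rw [zero_smul, add_zero] at this
    filter_upwards [this.eventually (hΩ.mem_nhds hx)] with t ht using huN _ ht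
  · have hd := ((hu.contDiffAt (hΩ.mem_nhds hx)).differentiableAt (by norm_num)).hasFDerivAt
    exact hd.hasLineDerivAt (EuclideanSpace.single α (1 : ℝ))

/-- The inequality form of the `p`-harmonic map equation. -/
theorem IsWeaklyPHarmonic.abs_integral_le (hp : 1 < p) {Ω : Set (Euc n)} (hΩ : IsOpen Ω)
    {N : Set (Euc k)} (hN : SecondFundamentalFormBound N Λ) {u : Euc n → Euc k}
    (huN : ∀ x ∈ Ω, u x ∈ N) (hu : ContDiffOn ℝ 1 u Ω) (hweak : IsWeaklyPHarmonic p Ω N u)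
    {O : Set (Euc n)} (hOΩ : O ⊆ Ω) {φ : Euc n → Euc k}
    (hφ : IsTestFunction 1 O φ) :
    |∫ x in O, inner ℝ (pField p (grad u x)) (grad φ x)| ≤
      |Λ| * ∫ x in O, ‖grad u x‖ ^ p * ‖φ x‖ := by
  obtain ⟨hφ1, hφc, hφO⟩ := hφ
  have hφΩ := hφO.trans hOΩ
  have heq := hweak φ ⟨hφ1, hφc, hφΩ⟩
  have e1 : ∀ x, gradNorm u x ^ (p - 2) *
      ∑ α, inner ℝ (partialDeriv α u x) (partialDeriv α φ x) =
      inner ℝ (pField p (grad u x)) (grad φ x) := fun x => by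
    rw [pField, real_inner_smul_left, inner_grad, norm_grad]
  simp_rw [e1] at heq
  have z1 : ∀ x, x ∉ tsupport φ → inner ℝ (pField p (grad u x)) (grad φ x) = 0 := fun x hx => by
    rw [grad_eq_zero hx, inner_zero_right]
  have z2 : ∀ x, x ∉ tsupport φ → ‖grad u x‖ ^ p * ‖φ x‖ = 0 := fun x hx => by
    rw [image_eq_zero_of_notMem_tsupport hx, norm_zero, mul_zero]
  rw [setIntegral_eq_integral_of_forall_compl_eq_zero fun x hx => z1 x fun h => hx (hφO h),
    setIntegral_eq_integral_of_forall_compl_eq_zero fun x hx => z2 x fun h => hx (hφO h),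
    ← setIntegral_eq_integral_of_forall_compl_eq_zero (s := Ω)
      fun x hx => z1 x fun h => hx (hφΩ h),
    ← setIntegral_eq_integral_of_forall_compl_eq_zero (s := Ω)
      fun x hx => z2 x fun h => hx (hφΩ h),
    eq_neg_of_add_eq_zero_left heq, abs_neg, ← Real.norm_eq_abs, ← integral_const_mul]
  have hint : Integrable fun x => ‖grad u x‖ ^ p * ‖φ x‖ := by
    refine integrable_of_continuousOn_tsupport (ContinuousOn.mul ?_ ?_) hφc z2
    · exact ((continuousOn_grad hΩ hu).mono hφΩ).norm.rpow_const fun _ _ => Or.inr (by linarith)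
    · exact hφ1.continuous.norm.continuousOn
  refine norm_integral_le_of_norm_le (hint.integrableOn.const_mul _) ?_
  filter_upwards [ae_restrict_mem hΩ.measurableSet] with x hx
  -- The sign of Λ is not prescribed, so |Λ| serves as the nonnegative constant from here on.
  have hb : ∀ α, ‖inner ℝ (secondFundamentalForm N (u x) (partialDeriv α u x)
      (partialDeriv α u x)) (φ x)‖ ≤ |Λ| * ‖partialDeriv α u x‖ ^ 2 * ‖φ x‖ := fun α => by
    have ht := partialDeriv_mem_tangentSpaceAt hΩ huN hu hx α
    refine (norm_inner_le_norm _ _).trans (mul_le_mul_of_nonneg_right ?_ (norm_nonneg _))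
    refine (hN _ (huN x hx) _ ht _ ht).trans ?_
    rw [mul_assoc, ← sq]
    exact mul_le_mul_of_nonneg_right (le_abs_self Λ) (sq_nonneg _)
  have hG : gradNorm u x ^ (p - 2) * gradNorm u x ^ 2 = gradNorm u x ^ p := by
    obtain h0 | h0 := (norm_nonneg (grad u x)).eq_or_lt
    · rw [← norm_grad, ← h0, Real.zero_rpow (by linarith : p ≠ 0)]
      simp
    · rw [norm_grad] at h0
      rw [← Real.rpow_natCast, ← Real.rpow_add h0]
      simp
  have hsq : gradNorm u x ^ 2 = ∑ α, ‖partialDeriv α u x‖ ^ 2 :=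
    Real.sq_sqrt (Finset.sum_nonneg fun _ _ => sq_nonneg _)
  have hG0 : 0 ≤ gradNorm u x := Real.sqrt_nonneg _
  rw [norm_mul, Real.norm_of_nonneg (Real.rpow_nonneg hG0 _)]
  calc _ ≤ gradNorm u x ^ (p - 2) * ∑ α, |Λ| * ‖partialDeriv α u x‖ ^ 2 * ‖φ x‖ :=
        mul_le_mul_of_nonneg_left ((norm_sum_le _ _).trans (Finset.sum_le_sum fun α _ => hb α))
          (Real.rpow_nonneg hG0 _)
    _ = |Λ| * (gradNorm u x ^ (p - 2) * gradNorm u x ^ 2 * ‖φ x‖) := by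
        rw [hsq, ← Finset.sum_mul, ← Finset.mul_sum]
        ring
    _ = _ := by rw [hG, norm_grad]

theorem exists_bound_scalarGrad {η : Euc n → ℝ} (hη : ContDiff ℝ 2 η)
    (hηc : HasCompactSupport η) :
    ∃ τ σ : ℝ, 0 ≤ τ ∧ 0 ≤ σ ∧ (∀ x, ‖scalarGrad η x‖ ≤ τ) ∧
      ∀ (β : Fin n) x, ‖fderiv ℝ (scalarGrad η) x (EuclideanSpace.single β 1)‖ ≤ σ := by
  have h1 := contDiff_scalarGrad hη
  have hc := hasCompactSupport_scalarGrad hηc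
  obtain ⟨τ, hτ⟩ := hc.exists_bound_of_continuous h1.continuous
  obtain ⟨σ, hσ⟩ := (hc.fderiv ℝ).exists_bound_of_continuous
    (h1.continuous_fderiv (by norm_num))
  refine ⟨τ, σ, (norm_nonneg _).trans (hτ 0), (norm_nonneg _).trans (hσ 0), hτ, fun β x => ?_⟩
  refine (ContinuousLinearMap.le_opNorm _ _).trans ?_
  simpa using hσ x

/-- Cutoff functions for concentric balls, with scale invariant bounds. -/
theorem exists_ball_cutoff (n : ℕ) :
    ∃ c d : ℝ, 0 ≤ c ∧ 0 ≤ d ∧ ∀ (x₀ : Euc n) (r : ℝ), 0 < r →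
      ∃ η : Euc n → ℝ, ContDiff ℝ 2 η ∧ HasCompactSupport η ∧ tsupport η ⊆ Metric.ball x₀ r ∧
        (∀ x, 0 ≤ η x ∧ η x ≤ 1) ∧ (∀ x ∈ Metric.ball x₀ (r / 2), η x = 1) ∧
        (∀ x, ‖scalarGrad η x‖ ≤ r⁻¹ * c) ∧
        ∀ (β : Fin n) x,
          ‖fderiv ℝ (scalarGrad η) x (EuclideanSpace.single β 1)‖ ≤ (r ^ 2)⁻¹ * d := by
  -- One bump is fixed for all balls, so c and d depend on n alone. The outer radius 3/4 < 1 puts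
  -- the closed support inside the open ball after scaling.
  let b : ContDiffBump (0 : Euc n) := ⟨1 / 2, 3 / 4, by norm_num, by norm_num⟩
  obtain ⟨c, d, hc, hd, hbc, hbd⟩ := exists_bound_scalarGrad (b.contDiff (n := 2))
    b.hasCompactSupport
  refine ⟨c, d, hc, hd, fun x₀ r hr => ?_⟩
  let T : Euc n → Euc n := fun x => r⁻¹ • (x - x₀)
  have hT : ∀ x, HasFDerivAt T (r⁻¹ • ContinuousLinearMap.id ℝ (Euc n)) x := fun x =>
    ((hasFDerivAt_id x).sub_const x₀).const_smul r⁻¹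
  have hTc : ContDiff ℝ 2 T := by fun_prop
  have hTn : ∀ x, ‖T x‖ = r⁻¹ * dist x x₀ := fun x => by
    simp [T, norm_smul, dist_eq_norm, abs_of_pos hr]
  have hg : scalarGrad (fun x => b (T x)) = fun x => r⁻¹ • scalarGrad b (T x) := by
    funext x
    ext α
    have h1 := (((b.contDiff (n := 1)).differentiable (by norm_num)) (T x)).hasFDerivAt.comp x
      (hT x)
    have h2 : fderiv ℝ (fun x => b (T x)) x = _ := h1.fderiv
    simp [scalarGrad, partialDeriv, h2]
  have hzero : ∀ x, x ∉ Metric.closedBall x₀ (3 / 4 * r) → b (T x) = 0 := fun x hx => by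
    apply b.zero_of_le_dist
    rw [dist_zero_right, hTn]
    rw [Metric.mem_closedBall, not_le] at hx
    change 3 / 4 ≤ _
    rw [le_inv_mul_iff₀ hr]
    linarith
  have hsupp : tsupport (fun x => b (T x)) ⊆ Metric.closedBall x₀ (3 / 4 * r) :=
    closure_minimal (fun x hx => by_contra fun h => hx (hzero x h)) Metric.isClosed_closedBall
  refine ⟨fun x => b (T x), b.contDiff.comp hTc, HasCompactSupport.intro
    (isCompact_closedBall _ _) hzero, hsupp.trans (Metric.closedBall_subset_ball (by linarith)),
    fun x => ⟨b.nonneg, b.le_one⟩, fun x hx => ?_, fun x => ?_, fun β x => ?_⟩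
  · apply b.one_of_mem_closedBall
    rw [Metric.mem_closedBall, dist_zero_right, hTn]
    rw [Metric.mem_ball] at hx
    change _ ≤ 1 / 2
    rw [inv_mul_le_iff₀ hr]
    linarith
  · rw [hg, norm_smul, Real.norm_of_nonneg (by positivity)]
    exact mul_le_mul_of_nonneg_left (hbc _) (by positivity)
  · have h1 := ((((contDiff_scalarGrad b.contDiff).differentiable (by norm_num))
      (T x)).hasFDerivAt.comp x (hT x)).const_smul r⁻¹
    have h2 : fderiv ℝ (fun x => r⁻¹ • scalarGrad b (T x)) x = _ := h1.fderiv
    rw [hg, h2]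
    simp only [smul_apply, ContinuousLinearMap.comp_apply,
      ContinuousLinearMap.id_apply, map_smul, smul_smul]
    rw [norm_smul, Real.norm_of_nonneg (by positivity), sq, mul_inv]
    exact mul_le_mul_of_nonneg_left (hbd β _) (by positivity)

theorem memLp_two_of_continuousOn_closure {V : Set (Euc n)} (hV : IsOpen V)
    (hVc : IsCompact (closure V)) {f : Euc n → Euc k} (hf : ContinuousOn f (closure V)) :
    MemLp f 2 (volume.restrict V) := by
  obtain ⟨C, hC⟩ := hVc.exists_bound_of_continuousOn hf
  have : IsFiniteMeasure (volume.restrict V) :=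
    ⟨by simpa using (measure_mono subset_closure).trans_lt hVc.measure_lt_top⟩
  refine MemLp.of_bound ((hf.mono subset_closure).aestronglyMeasurable hV.measurableSet) C ?_
  filter_upwards [ae_restrict_mem hV.measurableSet] with x hx using hC x (subset_closure hx)

/-- Interior `W^{2,2}` regularity of `C¹` `p`-harmonic maps. -/
theorem IsWeaklyPHarmonic.memW2pLoc (hp₁ : 1 < p) (hp₂ : p < 2) {Ω : Set (Euc n)}
    (hΩ : IsOpen Ω) {N : Set (Euc k)} (hN : SecondFundamentalFormBound N Λ) {u : Euc n → Euc k}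
    (huN : ∀ x ∈ Ω, u x ∈ N) (hu : ContDiffOn ℝ 1 u Ω) (hweak : IsWeaklyPHarmonic p Ω N u) :
    MemW2pLoc 2 Ω u := by
  intro V hV hVc hVΩ
  have hVΩ' := subset_closure.trans hVΩ
  have hw := fun α => hasWeakPartialDeriv_of_contDiffOn hV (hu.mono hVΩ') α
  refine ⟨⟨memLp_two_of_continuousOn_closure hV hVc (hu.continuousOn.mono hVΩ), fun α =>
    ⟨_, hw α, memLp_two_of_continuousOn_closure hV hVc
      ((continuousOn_partialDeriv hΩ hu α).mono hVΩ)⟩⟩, ?_⟩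
  -- On a relatively compact O the gradient is bounded and |∇u|^p is integrable, as the second
  -- derivative estimate requires.
  obtain ⟨O, hO, hVO, hOΩ, hOc⟩ := exists_open_between_and_isCompact_closure hVc hΩ hVΩ
  obtain ⟨η, O', hη, hηc, hηO, hη01, -, hVO', -, hη1⟩ := exists_smooth_cutoff hVc hO hVO
  have hη2 : ContDiff ℝ 2 η := by exact_mod_cast contDiff_infty.1 hη 2
  obtain ⟨τ, σ, -, -, hτ, hσ⟩ := exists_bound_scalarGrad hη2 hηc
  have hGc := (continuousOn_grad hΩ hu).mono hOΩ
  obtain ⟨M, hM⟩ := hOc.exists_bound_of_continuousOn hGc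
  have hint : IntegrableOn (fun x => ‖grad u x‖ ^ p) O :=
    ((hGc.norm.rpow_const fun _ _ => Or.inr (by linarith)).integrableOn_compact hOc).mono_set
      subset_closure
  have key := fun α β => exists_weak_second_deriv hp₁ hp₂ (abs_nonneg Λ) hO
    (hu.mono (subset_closure.trans hOΩ))
    (fun φ hφ => hweak.abs_integral_le hp₁ hΩ hN huN hu (subset_closure.trans hOΩ) hφ)
    hη2 hηc hηO hη01 hτ (hσ β) (le_max_right M 0)
    (fun x hx => (hM x (subset_closure hx)).trans (le_max_left M 0)) hint hV
    (fun x hx => hη1 x (hVO' (subset_closure hx))) α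
  choose H hH1 hH2 _ using key
  exact ⟨H, ⟨fun α => partialDeriv α u, hw, hH1⟩, hH2⟩

/-- With s = 1/r, τ = s c, σ = s² d and l = |Λ|, the constant from the cutoff estimate is a
quadratic form in (s, M). Its mixed terms are split by the arithmetic-geometric mean inequality. -/
theorem second_deriv_constant_le {c d l s M : ℝ} (hd : 0 ≤ d) (hp₁ : 1 < p) (hM : 0 ≤ M) :
    (2 * M) ^ (2 - p) * (2 / (p - 1) * ((p - 1)⁻¹ * (2 * (s * c) + l * M) ^ 2 +
        (2 * (s ^ 2 * d) + 2 * (l * (s * c) * M) + 2 * (s * c) ^ 2))) ≤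
      2 * (2 / (p - 1) * ((p - 1)⁻¹ * (8 * c ^ 2 + 2 * l ^ 2) + (2 * d + 3 * c ^ 2 + l ^ 2))) *
        (s ^ 2 + M ^ 2) * M ^ (2 - p) := by
  have hpc : 0 < p - 1 := by linarith
  have h2 : (2 * M) ^ (2 - p) ≤ 2 * M ^ (2 - p) := by
    rw [Real.mul_rpow zero_le_two hM]
    gcongr
    calc (2 : ℝ) ^ (2 - p) ≤ 2 ^ (1 : ℝ) := Real.rpow_le_rpow_of_exponent_le (by norm_num)
          (by linarith)
      _ = 2 := by simp
  have h3 : (2 * (s * c) + l * M) ^ 2 ≤ (8 * c ^ 2 + 2 * l ^ 2) * (s ^ 2 + M ^ 2) := by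
    nlinarith [sq_nonneg (2 * (s * c) - l * M), sq_nonneg (c * M), sq_nonneg (l * s)]
  have h4 : 2 * (s ^ 2 * d) + 2 * (l * (s * c) * M) + 2 * (s * c) ^ 2 ≤
      (2 * d + 3 * c ^ 2 + l ^ 2) * (s ^ 2 + M ^ 2) := by
    nlinarith [sq_nonneg (s * c - l * M), sq_nonneg (c * M), sq_nonneg (l * s),
      mul_nonneg hd (sq_nonneg M)]
  calc _ ≤ (2 * M) ^ (2 - p) * (2 / (p - 1) * ((p - 1)⁻¹ * ((8 * c ^ 2 + 2 * l ^ 2) *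
        (s ^ 2 + M ^ 2)) + (2 * d + 3 * c ^ 2 + l ^ 2) * (s ^ 2 + M ^ 2))) := by gcongr
    _ ≤ (2 * M ^ (2 - p)) * (2 / (p - 1) * ((p - 1)⁻¹ * ((8 * c ^ 2 + 2 * l ^ 2) *
        (s ^ 2 + M ^ 2)) + (2 * d + 3 * c ^ 2 + l ^ 2) * (s ^ 2 + M ^ 2))) := by gcongr
    _ = _ := by ring

end PHarmonicMaps

end PHarmonic

end

/-! ### The estimate on concentric balls -/

theorem propositionA1 (n k : ℕ) (p Λ : ℝ) (hp₁ : 1 < p) (hp₂ : p < 2) :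
    ∃ C : ℝ, 0 < C ∧
      ∀ (m : ℕ) (N : Set (PHarmonic.Euc k)), PHarmonic.IsC2Submanifold m N →
      PHarmonic.SecondFundamentalFormBound N Λ →
      ∀ (Ω : Set (PHarmonic.Euc n)), IsOpen Ω →
      ∀ u : PHarmonic.Euc n → PHarmonic.Euc k,
      (∀ x ∈ Ω, u x ∈ N) → ContDiffOn ℝ 1 u Ω →
      PHarmonic.MemW1p (ENNReal.ofReal p) Ω u →
      PHarmonic.IsWeaklyPHarmonic p Ω N u →
        PHarmonic.MemW2pLoc 2 {x | x ∈ Ω ∧ 0 < PHarmonic.gradNorm u x} u ∧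
        ∀ (x₀ : PHarmonic.Euc n) (r : ℝ), 0 < r → Metric.closedBall x₀ r ⊆ Ω →
          ∃ H : Fin n → Fin n → PHarmonic.Euc n → PHarmonic.Euc k,
            PHarmonic.HasWeakHessian (Metric.ball x₀ (r / 2)) u H ∧
            (∀ α β, MemLp (H α β) 2 (volume.restrict (Metric.ball x₀ (r / 2)))) ∧
            ∫ x in Metric.ball x₀ (r / 2), ∑ α, ∑ β, ‖H α β x‖ ^ 2 ≤
              C * ((r ^ 2)⁻¹ + sSup (PHarmonic.gradNorm u '' Metric.ball x₀ r) ^ 2) *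
                sSup (PHarmonic.gradNorm u '' Metric.ball x₀ r) ^ (2 - p) *
                ∫ x in Metric.ball x₀ r, PHarmonic.gradNorm u x ^ p := by
  obtain ⟨c, d, -, hd, hcut⟩ := PHarmonic.exists_ball_cutoff n
  have hpc : 0 < p - 1 := by linarith
  set C₀ : ℝ := 2 * (2 / (p - 1) * ((p - 1)⁻¹ * (8 * c ^ 2 + 2 * |Λ| ^ 2) +
    (2 * d + 3 * c ^ 2 + |Λ| ^ 2))) with hC₀
  have hC₀0 : 0 ≤ C₀ := by positivity
  -- There are n² components of the Hessian, each bounded with `C₀`; the summand 1 keeps the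
  -- constant positive also for n = 0.
  refine ⟨n * (n * C₀) + 1, by positivity, ?_⟩
  intro m N _ hN Ω hΩ u huN hu _ hweak
  refine ⟨fun V hV hVc hVΩ => hweak.memW2pLoc hp₁ hp₂ hΩ hN huN hu V hV hVc
    fun x hx => (hVΩ hx).1, ?_⟩
  intro x₀ r hr hball
  obtain ⟨η, hη, hηc, hηO, hη01, hη1, hτ, hσ⟩ := hcut x₀ r hr
  set M := sSup (PHarmonic.gradNorm u '' Metric.ball x₀ r) with hMdef
  have hBΩ : Metric.ball x₀ r ⊆ Ω := Metric.ball_subset_closedBall.trans hball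
  have hGc := (PHarmonic.continuousOn_grad hΩ hu).mono hball
  -- The bound on the closed ball makes the supremum M a genuine one: `sSup` of a set unbounded
  -- above would be 0.
  obtain ⟨M', hM'⟩ := (isCompact_closedBall x₀ r).exists_bound_of_continuousOn hGc
  have hM : ∀ x ∈ Metric.ball x₀ r, ‖PHarmonic.grad u x‖ ≤ M := fun x hx => by
    rw [PHarmonic.norm_grad]
    refine le_csSup ⟨M', ?_⟩ (mem_image_of_mem _ hx)
    rintro _ ⟨y, hy, rfl⟩
    rw [← PHarmonic.norm_grad]
    exact hM' y (Metric.ball_subset_closedBall hy)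
  have hM0 : 0 ≤ M := by
    refine Real.sSup_nonneg ?_
    rintro _ ⟨y, -, rfl⟩
    exact Real.sqrt_nonneg _
  have hint : IntegrableOn (fun x => ‖PHarmonic.grad u x‖ ^ p) (Metric.ball x₀ r) :=
    ((hGc.norm.rpow_const fun _ _ => Or.inr (by linarith)).integrableOn_compact
      (isCompact_closedBall x₀ r)).mono_set Metric.ball_subset_closedBall
  have key := fun α β => PHarmonic.exists_weak_second_deriv hp₁ hp₂ (abs_nonneg Λ)
    Metric.isOpen_ball (hu.mono hBΩ)
    (fun φ hφ => hweak.abs_integral_le hp₁ hΩ hN huN hu hBΩ hφ)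
    hη hηc hηO hη01 hτ (hσ β) hM0 hM hint (Metric.isOpen_ball (x := x₀) (ε := r / 2)) hη1 α
  choose H hH1 hH2 hH3 using key
  have hsub : Metric.ball x₀ (r / 2) ⊆ Ω :=
    (Metric.ball_subset_ball (by linarith)).trans hBΩ
  refine ⟨H, ⟨fun α => PHarmonic.partialDeriv α u, fun α =>
    PHarmonic.hasWeakPartialDeriv_of_contDiffOn Metric.isOpen_ball (hu.mono hsub) α, hH1⟩,
    hH2, ?_⟩
  simp only [PHarmonic.norm_grad] at hH3
  have hI0 : 0 ≤ ∫ x in Metric.ball x₀ r, PHarmonic.gradNorm u x ^ p :=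
    integral_nonneg fun x => Real.rpow_nonneg (Real.sqrt_nonneg _) _
  have hX : 0 ≤ ((r ^ 2)⁻¹ + M ^ 2) * M ^ (2 - p) *
      ∫ x in Metric.ball x₀ r, PHarmonic.gradNorm u x ^ p := by positivity
  have hH4 : ∀ α β, ∫ x in Metric.ball x₀ (r / 2), ‖H α β x‖ ^ 2 ≤
      C₀ * (((r ^ 2)⁻¹ + M ^ 2) * M ^ (2 - p) *
        ∫ x in Metric.ball x₀ r, PHarmonic.gradNorm u x ^ p) := fun α β => by
    refine (hH3 α β).trans ?_
    have h := PHarmonic.second_deriv_constant_le (c := c) (l := |Λ|) (s := r⁻¹) hd hp₁ hM0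
    rw [← hC₀, inv_pow] at h
    refine (mul_le_mul_of_nonneg_right h hI0).trans_eq ?_
    ring
  have hi : ∀ α β, IntegrableOn (fun x => ‖H α β x‖ ^ 2) (Metric.ball x₀ (r / 2)) :=
    fun α β => by simpa [IntegrableOn] using (hH2 α β).integrable_norm_pow (p := 2) (by norm_num)
  rw [integral_finsetSum _ fun α _ => integrable_finsetSum _ fun β _ => hi α β]
  simp_rw [integral_finsetSum _ fun β _ => hi _ β]
  refine (Finset.sum_le_sum fun α _ => Finset.sum_le_sum fun β _ => hH4 α β).trans ?_
  simp only [Finset.sum_const, Finset.card_univ, Fintype.card_fin, nsmul_eq_mul]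
  linear_combination hX
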